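/- Let $G$ be a topological group and let $f : G \to \mathbb{C}$ be almost periodic, i.e. bounded and continuous and such that the sets of left translates $\{x \mapsto f(sx) : s \in G\}$ and of right translates $\{x \mapsto f(xs) : s\in G\}$ are totally bounded for the supremum norm. Let $$d_f(a,b) = \sup_{x,y \in G} |f(xay) - f(xby)| ,$$ a two-sided invariant pseudometric on $G$, and let $G_f$ be the completion of $(G, d_f)$; it is a compact metrizable group. Equip $G_f$ with its Haar probability measure, write $F$ for the continuous extension of $f$ to $G_f$, and put $(g * h)(x) = \int_{G_f} g(y) h(y^{-1}x)\,dy$. Let $Z$ be the centre of the group algebra $L_1(G_f)$ (with the product $*$ and the involution $\tilde g(x) = \overline{g(x^{-1})}$), and let $\Sigma$ be the set of characters, i.e. of nonzero $*$-algebra morphisms $\sigma : Z \to \mathbb{C}$. For each $\sigma \in \Sigma$ there is exactly one continuous function $\chi_\sigma \in Z$ with $z * \chi_\sigma = \sigma(z)\chi_\sigma$ for all $z \in Z$ and $\sigma(\chi_\sigma) = 1$ (so $\chi_\sigma * \chi_\sigma = \chi_\sigma$), and $$F = \sum_{\sigma \in \Sigma} F * \chi_\sigma \quad\text{in } L_2(G_f)$$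 (unconditional convergence). Moreover each term $F * \chi_\sigma$ is minimal almost invariant, both as a function on $G_f$ and, restricted along the canonical map $G \to G_f$, as a function on $G$. Here a continuous function $h$ on a topological group $H$ is minimal almost invariant if its left translates span a finite-dimensional space, its right translates span a finite-dimensional space, and the space $A$ spanned by all translates $x \mapsto h(sxt)$, $s,t\in H$ (which is then finite-dimensional), has no nonzero subspace closed under left and right translations other than $A$ itself. -/

import Mathlib

open scoped BoundedContinuousFunction
open MeasureTheory

namespace AlmostPeriodic

section Completion

variable {G : Type*} [Group G] [TopologicalSpace G]

/-- The two-sided invariant pseudometric `d_f (a, b) = sup_{x, y} |f (x a y) - f (x b y)|`. -/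
noncomputable def apDist (f : G →ᵇ ℂ) (a b : G) : ℝ :=
  ⨆ p : G × G, ‖f (p.1 * a * p.2) - f (p.1 * b * p.2)‖

theorem apDist_bddAbove (f : G →ᵇ ℂ) (a b : G) :
    BddAbove (Set.range fun p : G × G => ‖f (p.1 * a * p.2) - f (p.1 * b * p.2)‖) := by
  refine ⟨2 * ‖f‖, ?_⟩
  rintro _ ⟨p, rfl⟩
  have h := f.dist_le_two_norm (p.1 * a * p.2) (p.1 * b * p.2)
  rwa [dist_eq_norm] at h

theorem le_apDist (f : G →ᵇ ℂ) (a b x y : G) :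
    ‖f (x * a * y) - f (x * b * y)‖ ≤ apDist f a b :=
  le_ciSup (apDist_bddAbove f a b) (x, y)

theorem apDist_le (f : G →ᵇ ℂ) {a b : G} {c : ℝ}
    (h : ∀ x y, ‖f (x * a * y) - f (x * b * y)‖ ≤ c) : apDist f a b ≤ c :=
  ciSup_le fun p => h p.1 p.2

theorem apDist_comm (f : G →ᵇ ℂ) (a b : G) : apDist f a b = apDist f b a := by
  simp only [apDist, norm_sub_rev]

theorem apDist_triangle (f : G →ᵇ ℂ) (a b c : G) :
    apDist f a c ≤ apDist f a b + apDist f b c := by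
  refine apDist_le f fun x y => (norm_sub_le_norm_sub_add_norm_sub _ (f (x * b * y)) _).trans ?_
  exact add_le_add (le_apDist f a b x y) (le_apDist f b c x y)

theorem apDist_mul_left_le (f : G →ᵇ ℂ) (c a b : G) :
    apDist f (c * a) (c * b) ≤ apDist f a b :=
  apDist_le f fun x y => by simpa only [mul_assoc] using le_apDist f a b (x * c) y

theorem apDist_mul_right_le (f : G →ᵇ ℂ) (c a b : G) :
    apDist f (a * c) (b * c) ≤ apDist f a b :=
  apDist_le f fun x y => by simpa only [mul_assoc] using le_apDist f a b x (c * y)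

theorem apDist_inv_le (f : G →ᵇ ℂ) (a b : G) : apDist f a⁻¹ b⁻¹ ≤ apDist f a b := by
  refine apDist_le f fun x y => ?_
  have h := le_apDist f b a (x * a⁻¹) (b⁻¹ * y)
  rw [apDist_comm f b a] at h
  simpa only [mul_assoc, inv_mul_cancel_left, mul_inv_cancel_left] using h

/-- The group `G`, considered with the pseudometric `d_f`. -/
@[nolint unusedArguments]
def PseudoGroup (_f : G →ᵇ ℂ) : Type _ := G

/-- The identity map from `G` to `(G, d_f)`. -/
def PseudoGroup.mk (f : G →ᵇ ℂ) (a : G) : PseudoGroup f := a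

/-- The identity map from `(G, d_f)` to `G`. -/
def PseudoGroup.val {f : G →ᵇ ℂ} (a : PseudoGroup f) : G := a

instance (f : G →ᵇ ℂ) : Group (PseudoGroup f) := inferInstanceAs (Group G)

noncomputable instance (f : G →ᵇ ℂ) : PseudoMetricSpace (PseudoGroup f) where
  dist a b := apDist (G := G) f a b
  dist_self a := by simp [apDist]
  dist_comm a b := apDist_comm (G := G) f a b
  dist_triangle a b c := apDist_triangle (G := G) f a b c

theorem PseudoGroup.dist_def (f : G →ᵇ ℂ) (a b : PseudoGroup f) :
    dist a b = apDist (G := G) f a b := rfl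

theorem PseudoGroup.uniformContinuous_mul (f : G →ᵇ ℂ) :
    UniformContinuous₂ ((· * ·) : PseudoGroup f → PseudoGroup f → PseudoGroup f) := by
  refine Metric.uniformContinuous_iff.2 fun ε hε => ⟨ε / 2, half_pos hε, ?_⟩
  rintro ⟨a, b⟩ ⟨a', b'⟩ h
  obtain ⟨h₁, h₂⟩ := max_lt_iff.1 h
  calc dist (a * b) (a' * b') ≤ dist (a * b) (a' * b) + dist (a' * b) (a' * b') :=
        dist_triangle _ _ _
    _ ≤ dist a a' + dist b b' :=
        add_le_add (apDist_mul_right_le (G := G) f b a a') (apDist_mul_left_le (G := G) f a' b b')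
    _ < ε := by dsimp only at h₁ h₂; linarith

theorem PseudoGroup.uniformContinuous_inv (f : G →ᵇ ℂ) :
    UniformContinuous (Inv.inv : PseudoGroup f → PseudoGroup f) :=
  Metric.uniformContinuous_iff.2 fun ε hε =>
    ⟨ε, hε, fun _ _ h => (apDist_inv_le (G := G) f _ _).trans_lt h⟩

theorem PseudoGroup.uniformContinuous_apply (f : G →ᵇ ℂ) :
    UniformContinuous (fun a : PseudoGroup f => f a.val) :=
  Metric.uniformContinuous_iff.2 fun ε hε => ⟨ε, hε, fun a b h => by
    have h1 := le_apDist f a.val b.val 1 1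
    rw [one_mul, one_mul, mul_one, mul_one, ← dist_eq_norm] at h1
    exact h1.trans_lt h⟩

variable [IsTopologicalGroup G]

/-- The left translate `T_s g : x ↦ g (s x)` of a bounded continuous function. -/
noncomputable def leftTranslate (s : G) (g : G →ᵇ ℂ) : G →ᵇ ℂ :=
  g.compContinuous ⟨fun x => s * x, continuous_const_mul s⟩

/-- The right translate `T^s g : x ↦ g (x s)` of a bounded continuous function. -/
noncomputable def rightTranslate (s : G) (g : G →ᵇ ℂ) : G →ᵇ ℂ :=
  g.compContinuous ⟨fun x => x * s, continuous_mul_const s⟩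

/-- A bounded continuous function is almost periodic if the set of its left translates and the
set of its right translates are both totally bounded for the supremum norm. -/
structure IsAlmostPeriodic (f : G →ᵇ ℂ) : Prop where
  left : TotallyBounded (Set.range fun s : G => leftTranslate s f)
  right : TotallyBounded (Set.range fun s : G => rightTranslate s f)

/-- If the left translates of `f` are totally bounded, then so is `(G, d_f)`. -/
theorem PseudoGroup.totallyBounded_univ {f : G →ᵇ ℂ} (hf : IsAlmostPeriodic f) :
    TotallyBounded (Set.univ : Set (PseudoGroup f)) := by
  classical
  refine Metric.totallyBounded_of_finite_discretization fun ε hε => ?_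
  have h4 : 0 < ε / 8 := by positivity
  obtain ⟨t, htsub, htfin, htcov⟩ :=
    Metric.finite_approx_of_totallyBounded hf.left (ε / 8) h4
  have key : ∀ s : G, ∃ i : t, dist (leftTranslate s f) i < ε / 8 := fun s => by
    have := htcov ⟨s, rfl⟩
    simp only [Set.mem_iUnion, Metric.mem_ball] at this
    obtain ⟨i, hi, hd⟩ := this
    exact ⟨⟨i, hi⟩, hd⟩
  choose ind hind using key
  have key2 : ∀ i : t, ∃ s : G, leftTranslate s f = i := fun i => htsub i.2
  choose pt hpt using key2
  have : Fintype t := htfin.fintype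
  refine ⟨t → t, inferInstance, fun a i => ind (pt i * a.1.val), ?_⟩
  rintro ⟨a, ha⟩ ⟨b, hb⟩ hab
  change apDist f a.val b.val < ε
  have hpw : ∀ s (i : t) z, dist (leftTranslate s f) i < ε / 8 → ‖f (s * z) - i.1 z‖ < ε / 8 :=
    fun s i z h => by
      rw [← dist_eq_norm]
      exact (BoundedContinuousFunction.dist_coe_le_dist (f := leftTranslate s f) z).trans_lt h
  refine (apDist_le (G := G) f (c := ε / 2) fun x y => ?_).trans_lt (half_lt_self hε)
  set i := ind x
  have e : ∀ z, i.1 z = f (pt i * z) := fun z => by rw [← hpt i]; rfl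
  have h1 := hpw x i (a.val * y) (hind x)
  have h2 := hpw x i (b.val * y) (hind x)
  have h3 := hpw _ _ y (hind (pt i * a.val))
  have h4 := hpw _ _ y (hind (pt i * b.val))
  have hi : ind (pt i * a.val) = ind (pt i * b.val) := congrFun hab i
  rw [e, ← mul_assoc, ← mul_assoc] at h1 h2
  rw [hi] at h3
  rw [← dist_eq_norm] at *
  rw [dist_comm] at h2 h4
  have t1 := dist_triangle4 (f (x * a.val * y)) (f (pt i * a.val * y))
    (f (pt i * b.val * y)) (f (x * b.val * y))
  have t2 := dist_triangle (f (pt i * a.val * y))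
    ((ind (pt i * b.val)).1 y) (f (pt i * b.val * y))
  linarith

/-- `G_f`, the completion of `(G, d_f)`. -/
@[nolint unusedArguments]
def APCompletion (f : G →ᵇ ℂ) (_hf : IsAlmostPeriodic f) : Type _ :=
  UniformSpace.Completion (PseudoGroup f)

namespace APCompletion

open UniformSpace

variable (f : G →ᵇ ℂ) (hf : IsAlmostPeriodic f)

noncomputable instance : MetricSpace (APCompletion f hf) :=
  inferInstanceAs (MetricSpace (Completion (PseudoGroup f)))

/-- The canonical map from `G` to its completion `G_f`. -/
noncomputable def ofGroup (a : G) : APCompletion f hf :=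
  (PseudoGroup.mk f a : Completion (PseudoGroup f))

theorem dist_ofGroup (a b : G) : dist (ofGroup f hf a) (ofGroup f hf b) = apDist f a b :=
  Completion.dist_eq (PseudoGroup.mk f a) (PseudoGroup.mk f b)

theorem denseRange_ofGroup : DenseRange (ofGroup f hf) :=
  Completion.denseRange_coe (α := PseudoGroup f)

instance : CompleteSpace (APCompletion f hf) :=
  inferInstanceAs (CompleteSpace (Completion (PseudoGroup f)))

instance : CompactSpace (APCompletion f hf) := by
  refine ⟨?_⟩
  have h : TotallyBounded (Set.range ((↑) : PseudoGroup f → Completion (PseudoGroup f))) := by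
    rw [← Set.image_univ]
    exact (PseudoGroup.totallyBounded_univ hf).image (Completion.uniformContinuous_coe _)
  have h' := h.closure
  rw [Completion.denseRange_coe.closure_range] at h'
  exact TotallyBounded.isCompact_of_isClosed (α := APCompletion f hf) h' isClosed_univ

noncomputable instance : Mul (APCompletion f hf) where
  mul := Completion.map₂ ((· * ·) : PseudoGroup f → PseudoGroup f → PseudoGroup f)

noncomputable instance : Inv (APCompletion f hf) where
  inv := Completion.map (Inv.inv : PseudoGroup f → PseudoGroup f)

noncomputable instance : One (APCompletion f hf) where
  one := ofGroup f hf 1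

theorem ofGroup_mul (a b : G) : ofGroup f hf (a * b) = ofGroup f hf a * ofGroup f hf b :=
  (Completion.map₂_coe_coe (α := PseudoGroup f) (β := PseudoGroup f) a b _
    (PseudoGroup.uniformContinuous_mul f)).symm

theorem ofGroup_inv (a : G) : ofGroup f hf a⁻¹ = (ofGroup f hf a)⁻¹ :=
  (Completion.map_coe (PseudoGroup.uniformContinuous_inv f) a).symm

theorem ofGroup_one : ofGroup f hf 1 = 1 := rfl

instance : ContinuousMul (APCompletion f hf) where
  continuous_mul := Completion.continuous_map₂ (α := PseudoGroup f) (β := PseudoGroup f)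
    (γ := PseudoGroup f) (f := (· * ·)) continuous_fst continuous_snd

instance : ContinuousInv (APCompletion f hf) where
  continuous_inv := Completion.continuous_map (f := (Inv.inv : PseudoGroup f → PseudoGroup f))

noncomputable instance : Group (APCompletion f hf) :=
  Group.ofLeftAxioms
    (fun a b c => (denseRange_ofGroup f hf).induction_on₃
      (isClosed_eq (by fun_prop) (by fun_prop))
      (fun a b c => by simp only [← ofGroup_mul, mul_assoc]) a b c)
    (fun a => (denseRange_ofGroup f hf).induction_on (p := fun a => 1 * a = a) a
      (isClosed_eq (by fun_prop) (by fun_prop))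
      (fun a => by rw [← ofGroup_one, ← ofGroup_mul, one_mul]))
    (fun a => (denseRange_ofGroup f hf).induction_on (p := fun a => a⁻¹ * a = 1) a
      (isClosed_eq (by fun_prop) (by fun_prop))
      (fun a => by rw [← ofGroup_inv, ← ofGroup_mul, inv_mul_cancel, ofGroup_one]))

instance : IsTopologicalGroup (APCompletion f hf) where

noncomputable instance : MeasurableSpace (APCompletion f hf) := borel _

instance : BorelSpace (APCompletion f hf) := ⟨rfl⟩

/-- `f`, considered as a continuous function on `G_f`. -/
noncomputable def extension : C(APCompletion f hf, ℂ) where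
  toFun := Completion.extension (fun a : PseudoGroup f => f a.val)
  continuous_toFun := Completion.continuous_extension

theorem extension_ofGroup (a : G) : extension f hf (ofGroup f hf a) = f a :=
  Completion.extension_coe (PseudoGroup.uniformContinuous_apply f) (PseudoGroup.mk f a)


end APCompletion

end Completion

section GroupAlgebra

set_option linter.unusedSectionVars false

variable (K : Type*) [Group K] [TopologicalSpace K] [IsTopologicalGroup K] [CompactSpace K]
  [MeasurableSpace K] [BorelSpace K]

/-- The Haar probability measure of a compact group. -/
noncomputable def haarProb : Measure K := Measure.haarMeasure ⊤

instance : (haarProb K).IsHaarMeasure := Measure.isHaarMeasure_haarMeasure ⊤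

instance : IsProbabilityMeasure (haarProb K) :=
  ⟨Measure.haarMeasure_self (K₀ := (⊤ : TopologicalSpace.PositiveCompacts K))⟩

instance : (haarProb K).IsMulRightInvariant := by
  refine ⟨fun g => ?_⟩
  have hp : IsProbabilityMeasure ((haarProb K).map (· * g)) :=
    Measure.isProbabilityMeasure_map (by fun_prop)
  exact Measure.isHaarMeasure_eq_of_isProbabilityMeasure _ _

instance : (haarProb K).IsInvInvariant := by
  refine ⟨?_⟩
  have hp : IsProbabilityMeasure (haarProb K).inv :=
    Measure.isProbabilityMeasure_map (by fun_prop)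
  have h := Measure.isMulInvariant_eq_smul_of_compactSpace (haarProb K).inv (haarProb K)
  have h1 := congrArg (fun ν : Measure K => ν Set.univ) h
  simp only [measure_univ, Measure.smul_apply, ENNReal.smul_def, smul_eq_mul, mul_one] at h1
  rw [h, (by exact_mod_cast h1.symm : Measure.haarScalarFactor (haarProb K).inv (haarProb K) = 1),
    one_smul]

variable {K}

/-- Convolution of functions on a compact group: `(f ∗ g) x = ∫ f y g (y⁻¹ x) dy`. -/
noncomputable def conv (f g : K → ℂ) (x : K) : ℂ :=
  ∫ y, f y * g (y⁻¹ * x) ∂haarProb K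

theorem conv_congr {f f' g g' : K → ℂ} (hf : f =ᵐ[haarProb K] f') (hg : g =ᵐ[haarProb K] g') :
    conv f g = conv f' g' := by
  funext x
  have h : MeasurePreserving (fun y : K => y⁻¹ * x) (haarProb K) (haarProb K) :=
    (measurePreserving_mul_right _ x).comp (Measure.measurePreserving_inv _)
  refine integral_congr_ae ?_
  filter_upwards [hf, h.quasiMeasurePreserving.ae hg] with y h1 h2
  rw [h1, h2]

variable [SecondCountableTopology K]

theorem integrable_conv_prod {f g : K → ℂ} (hf : Integrable f (haarProb K))
    (hg : Integrable g (haarProb K)) :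
    Integrable (fun p : K × K => f p.1 * g (p.1⁻¹ * p.2)) ((haarProb K).prod (haarProb K)) :=
  (measurePreserving_prod_inv_mul (haarProb K) (haarProb K)).integrable_comp_of_integrable
    (hf.mul_prod hg)

theorem integrable_conv {f g : K → ℂ} (hf : Integrable f (haarProb K))
    (hg : Integrable g (haarProb K)) : Integrable (conv f g) (haarProb K) :=
  (integrable_conv_prod hf hg).integral_prod_right

theorem conv_ae_integrable {f g : K → ℂ} (hf : Integrable f (haarProb K))
    (hg : Integrable g (haarProb K)) :
    ∀ᵐ x ∂haarProb K, Integrable (fun y => f y * g (y⁻¹ * x)) (haarProb K) :=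
  (integrable_conv_prod hf hg).prod_left_ae

theorem conv_add_left {f f' g : K → ℂ} (hf : Integrable f (haarProb K))
    (hf' : Integrable f' (haarProb K)) (hg : Integrable g (haarProb K)) :
    conv (f + f') g =ᵐ[haarProb K] conv f g + conv f' g := by
  filter_upwards [conv_ae_integrable hf hg, conv_ae_integrable hf' hg] with x h h'
  simp only [conv, Pi.add_apply, add_mul]
  exact integral_add h h'

theorem conv_add_right {f g g' : K → ℂ} (hf : Integrable f (haarProb K))
    (hg : Integrable g (haarProb K)) (hg' : Integrable g' (haarProb K)) :
    conv f (g + g') =ᵐ[haarProb K] conv f g + conv f g' := by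
  filter_upwards [conv_ae_integrable hf hg, conv_ae_integrable hf hg'] with x h h'
  simp only [conv, Pi.add_apply, mul_add]
  exact integral_add h h'

theorem conv_assoc {f g h : K → ℂ} (hf : Integrable f (haarProb K))
    (hg : Integrable g (haarProb K)) (hh : Integrable h (haarProb K)) :
    conv (conv f g) h =ᵐ[haarProb K] conv f (conv g h) := by
  have hmp : MeasurePreserving (fun q : (K × K) × K => (q.1, q.1.2⁻¹ * q.2))
      (((haarProb K).prod (haarProb K)).prod (haarProb K))
      (((haarProb K).prod (haarProb K)).prod (haarProb K)) :=
    (MeasurePreserving.id _).skew_product (g := fun (p : K × K) y => p.2⁻¹ * y) (by fun_prop)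
      (Filter.Eventually.of_forall fun p => map_mul_left_eq_self _ _)
  have hint := hmp.integrable_comp_of_integrable ((integrable_conv_prod hf hg).mul_prod hh)
  filter_upwards [hint.prod_left_ae] with x hx
  calc conv (conv f g) h x
      = ∫ y, ∫ z, f z * g (z⁻¹ * y) * h (y⁻¹ * x) ∂haarProb K ∂haarProb K := by
        simp only [conv, integral_mul_const]
    _ = ∫ z, ∫ y, f z * g (z⁻¹ * y) * h (y⁻¹ * x) ∂haarProb K ∂haarProb K :=
        (integral_integral_swap hx).symm
    _ = ∫ z, ∫ y, f z * g y * h (y⁻¹ * (z⁻¹ * x)) ∂haarProb K ∂haarProb K := by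
        refine integral_congr_ae (Filter.Eventually.of_forall fun z => ?_)
        dsimp only
        rw [← integral_mul_left_eq_self (fun y => f z * g (z⁻¹ * y) * h (y⁻¹ * x)) z]
        simp only [inv_mul_cancel_left, mul_inv_rev, mul_assoc]
    _ = conv f (conv g h) x := by
        simp only [conv, mul_assoc, integral_const_mul]

/-- The involution `f̃ x = conj (f x⁻¹)`. -/
noncomputable def invol (f : K → ℂ) (x : K) : ℂ := star (f x⁻¹)

theorem invol_congr {f f' : K → ℂ} (hf : f =ᵐ[haarProb K] f') :
    invol f =ᵐ[haarProb K] invol f' := by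
  filter_upwards [(Measure.measurePreserving_inv (haarProb K)).quasiMeasurePreserving.ae hf]
    with x h
  simp only [invol, h]

theorem integrable_invol {f : K → ℂ} (hf : Integrable f (haarProb K)) :
    Integrable (invol f) (haarProb K) :=
  (RCLike.conjCLE (K := ℂ)).toContinuousLinearMap.integrable_comp hf.comp_inv

theorem invol_conv (f g : K → ℂ) : invol (conv f g) = conv (invol g) (invol f) := by
  funext x
  simp only [invol, conv]
  rw [← integral_mul_left_eq_self (fun y => star (g y⁻¹) * star (f (y⁻¹ * x)⁻¹)) x]
  simp only [mul_inv_rev, inv_inv, inv_mul_cancel_left]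
  rw [show star (∫ y, f y * g (y⁻¹ * x⁻¹) ∂haarProb K)
    = ∫ y, star (f y * g (y⁻¹ * x⁻¹)) ∂haarProb K from integral_conj.symm]
  simp only [star_mul]

variable (K)

/-- The group algebra: `L₁ (K)` with convolution as multiplication and `f ↦ f̃` as involution. -/
def GroupAlgebra : Type _ := Lp ℂ 1 (haarProb K)

namespace GroupAlgebra

noncomputable instance : NormedAddCommGroup (GroupAlgebra K) :=
  inferInstanceAs (NormedAddCommGroup (Lp ℂ 1 (haarProb K)))

noncomputable instance : NormedSpace ℂ (GroupAlgebra K) :=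
  inferInstanceAs (NormedSpace ℂ (Lp ℂ 1 (haarProb K)))

instance : CompleteSpace (GroupAlgebra K) :=
  inferInstanceAs (CompleteSpace (Lp ℂ 1 (haarProb K)))

variable {K}

/-- An element of the group algebra, as an element of `L₁ (K)`. -/
def toLp (a : GroupAlgebra K) : Lp ℂ 1 (haarProb K) := a

/-- A representative of an element of the group algebra. -/
noncomputable def toFun (a : GroupAlgebra K) : K → ℂ :=
  (a.toLp : K → ℂ)

/-- The class of an integrable function. -/
noncomputable def mk (f : K → ℂ) (hf : Integrable f (haarProb K)) : GroupAlgebra K := hf.toL1 f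

theorem integrable_toFun (a : GroupAlgebra K) : Integrable a.toFun (haarProb K) :=
  L1.integrable_coeFn _

theorem toFun_mk (f : K → ℂ) (hf : Integrable f (haarProb K)) : (mk f hf).toFun =ᵐ[haarProb K] f :=
  hf.coeFn_toL1

theorem ext_ae {a b : GroupAlgebra K} (h : a.toFun =ᵐ[haarProb K] b.toFun) : a = b := Lp.ext h

theorem mk_eq_mk {f g : K → ℂ} (hf : Integrable f (haarProb K)) (hg : Integrable g (haarProb K))
    (h : f =ᵐ[haarProb K] g) : mk f hf = mk g hg :=
  (Integrable.toL1_eq_toL1_iff f g hf hg).2 h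

theorem toFun_add (a b : GroupAlgebra K) : (a + b).toFun =ᵐ[haarProb K] a.toFun + b.toFun :=
  Lp.coeFn_add (p := 1) (μ := haarProb K) _ _

theorem toFun_smul (c : ℂ) (a : GroupAlgebra K) : (c • a).toFun =ᵐ[haarProb K] c • a.toFun :=
  Lp.coeFn_smul (p := 1) (μ := haarProb K) _ _

theorem toFun_zero : (0 : GroupAlgebra K).toFun =ᵐ[haarProb K] 0 :=
  Lp.coeFn_zero ..

noncomputable instance : Mul (GroupAlgebra K) where
  mul a b := mk (conv a.toFun b.toFun) (integrable_conv a.integrable_toFun b.integrable_toFun)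

noncomputable instance : Star (GroupAlgebra K) where
  star a := mk (invol a.toFun) (integrable_invol a.integrable_toFun)

theorem toFun_mul (a b : GroupAlgebra K) :
    (a * b).toFun =ᵐ[haarProb K] conv a.toFun b.toFun := toFun_mk _ _

theorem toFun_star (a : GroupAlgebra K) : (star a).toFun =ᵐ[haarProb K] invol a.toFun :=
  toFun_mk _ _

noncomputable instance : NonUnitalRing (GroupAlgebra K) :=
  { (inferInstance : AddCommGroup (GroupAlgebra K)),
    (inferInstance : Mul (GroupAlgebra K)) with
    left_distrib := fun a b c => ext_ae <| by
      refine (toFun_mul _ _).trans ?_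
      rw [conv_congr (Filter.EventuallyEq.refl _ _) (toFun_add b c)]
      exact (conv_add_right a.integrable_toFun b.integrable_toFun c.integrable_toFun).trans
        (((toFun_mul a b).add (toFun_mul a c)).symm.trans (toFun_add _ _).symm)
    right_distrib := fun a b c => ext_ae <| by
      refine (toFun_mul _ _).trans ?_
      rw [conv_congr (toFun_add a b) (Filter.EventuallyEq.refl _ _)]
      exact (conv_add_left a.integrable_toFun b.integrable_toFun c.integrable_toFun).trans
        (((toFun_mul a c).add (toFun_mul b c)).symm.trans (toFun_add _ _).symm)
    zero_mul := fun a => ext_ae <| by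
      refine ((toFun_mul _ _).trans ?_).trans toFun_zero.symm
      rw [conv_congr toFun_zero (Filter.EventuallyEq.refl _ _)]
      exact Filter.Eventually.of_forall fun x => by simp [conv]
    mul_zero := fun a => ext_ae <| by
      refine ((toFun_mul _ _).trans ?_).trans toFun_zero.symm
      rw [conv_congr (Filter.EventuallyEq.refl _ _) toFun_zero]
      exact Filter.Eventually.of_forall fun x => by simp [conv]
    mul_assoc := fun a b c => ext_ae <| by
      refine (toFun_mul _ _).trans (Filter.EventuallyEq.trans ?_ (toFun_mul _ _).symm)
      rw [conv_congr (toFun_mul a b) (Filter.EventuallyEq.refl _ _),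
        conv_congr (Filter.EventuallyEq.refl _ _) (toFun_mul b c)]
      exact conv_assoc a.integrable_toFun b.integrable_toFun c.integrable_toFun }

instance : IsScalarTower ℂ (GroupAlgebra K) (GroupAlgebra K) where
  smul_assoc c a b := ext_ae <| by
    change (c • a * b).toFun =ᵐ[haarProb K] (c • (a * b)).toFun
    refine (toFun_mul _ _).trans (Filter.EventuallyEq.trans ?_ (toFun_smul _ _).symm)
    rw [conv_congr (toFun_smul c a) (Filter.EventuallyEq.refl _ _)]
    filter_upwards [toFun_mul a b] with x hx
    simp only [Pi.smul_apply, hx, conv, smul_eq_mul, mul_assoc, integral_const_mul]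

instance : SMulCommClass ℂ (GroupAlgebra K) (GroupAlgebra K) where
  smul_comm c a b := ext_ae <| by
    change (c • (a * b)).toFun =ᵐ[haarProb K] (a * c • b).toFun
    refine Filter.EventuallyEq.symm ?_
    refine (toFun_mul _ _).trans (Filter.EventuallyEq.trans ?_ (toFun_smul _ _).symm)
    rw [conv_congr (Filter.EventuallyEq.refl _ _) (toFun_smul c b)]
    filter_upwards [toFun_mul a b] with x hx
    simp only [Pi.smul_apply, hx, conv, smul_eq_mul, mul_left_comm _ c, integral_const_mul]

noncomputable instance : StarRing (GroupAlgebra K) where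
  star_involutive a := ext_ae <| by
    refine (toFun_star _).trans ((invol_congr (toFun_star a)).trans ?_)
    exact Filter.Eventually.of_forall fun x => by simp [invol]
  star_mul a b := ext_ae <| by
    refine (toFun_star _).trans ((invol_congr (toFun_mul a b)).trans ?_)
    rw [invol_conv, ← conv_congr (toFun_star b) (toFun_star a)]
    exact (toFun_mul _ _).symm
  star_add a b := ext_ae <| by
    refine (toFun_star _).trans ((invol_congr (toFun_add a b)).trans ?_)
    refine Filter.EventuallyEq.trans ?_ (toFun_add _ _).symm
    filter_upwards [toFun_star a, toFun_star b] with x h1 h2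
    simp only [Pi.add_apply, h1, h2, invol, star_add]

instance : StarModule ℂ (GroupAlgebra K) where
  star_smul c a := ext_ae <| by
    refine (toFun_star _).trans ((invol_congr (toFun_smul c a)).trans ?_)
    refine Filter.EventuallyEq.trans ?_ (toFun_smul _ _).symm
    filter_upwards [toFun_star a] with x h
    simp only [Pi.smul_apply, h, invol, star_smul]

end GroupAlgebra

/-- The centre `Z` of the group algebra, as a *-algebra. -/
noncomputable abbrev groupCenter : NonUnitalStarSubalgebra ℂ (GroupAlgebra K) :=
  NonUnitalStarSubalgebra.center ℂ (GroupAlgebra K)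

/-- A character of `K` is a nonzero *-algebra morphism from the centre of the group algebra
to `ℂ`. -/
def Character : Type _ := {σ : groupCenter K →⋆ₙₐ[ℂ] ℂ // σ ≠ 0}

variable {K}

theorem integrable_continuousMap (χ : C(K, ℂ)) : Integrable χ (haarProb K) :=
  χ.continuous.integrable_of_hasCompactSupport (HasCompactSupport.of_compactSpace _)

/-- The continuous function `χ` is the projection in the centre `Z` that belongs to the
character `σ`: one has `z ∗ χ = σ (z) χ` for all `z` in `Z`, and `σ (χ) = 1`. -/
def IsCharacterFunction (σ : Character K) (χ : C(K, ℂ)) : Prop :=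
  ∃ h : GroupAlgebra.mk χ (integrable_continuousMap χ) ∈ groupCenter K,
    (∀ z : groupCenter K, (z : GroupAlgebra K) * GroupAlgebra.mk χ (integrable_continuousMap χ) =
      σ.1 z • GroupAlgebra.mk χ (integrable_continuousMap χ)) ∧
    σ.1 ⟨_, h⟩ = 1

end GroupAlgebra

section AlmostInvariant

variable {H : Type*} [Group H] [TopologicalSpace H]

/-- The span of the left translates `x ↦ h (s x)` of `h`. -/
def leftSpan (h : H → ℂ) : Submodule ℂ (H → ℂ) :=
  Submodule.span ℂ (Set.range fun s : H => fun x => h (s * x))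

/-- The span of the right translates `x ↦ h (x s)` of `h`. -/
def rightSpan (h : H → ℂ) : Submodule ℂ (H → ℂ) :=
  Submodule.span ℂ (Set.range fun s : H => fun x => h (x * s))

/-- The span of all translates `x ↦ h (s x t)` of `h`. -/
def translationSpan (h : H → ℂ) : Submodule ℂ (H → ℂ) :=
  Submodule.span ℂ (Set.range fun p : H × H => fun x => h (p.1 * x * p.2))

/-- A continuous function is almost invariant if its left translates span a finite-dimensional
space, and so do its right translates. -/
structure IsAlmostInvariant (h : H → ℂ) : Prop where
  continuous : Continuous h
  left : FiniteDimensional ℂ (leftSpan h)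
  right : FiniteDimensional ℂ (rightSpan h)

/-- A space of functions is translation invariant if it is closed under left and right
translations. -/
def IsTranslationInvariant (W : Submodule ℂ (H → ℂ)) : Prop :=
  ∀ g ∈ W, ∀ s : H, (fun x => g (s * x)) ∈ W ∧ (fun x => g (x * s)) ∈ W

/-- An almost invariant function is minimal if the (finite-dimensional) space spanned by its
translates has no nonzero translation invariant subspace other than itself. -/
structure IsMinimalAlmostInvariant (h : H → ℂ) : Prop extends IsAlmostInvariant h where
  finiteDimensional : FiniteDimensional ℂ (translationSpan h)
  minimal : ∀ W : Submodule ℂ (H → ℂ), W ≤ translationSpan h → W ≠ ⊥ →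
    IsTranslationInvariant W → W = translationSpan h

end AlmostInvariant

end AlmostPeriodic

/-!
The group `G_f` is a compact group with a bi-invariant metric, and the statement is a form of the
Peter–Weyl theorem for such a group `K`, organized around the centre `Z` of `L₁ (K)`.

*Units of bi-invariant spaces.* On a finite-dimensional space `W` of continuous functions that is
closed under left and right translations, evaluation at the identity is represented in `L₂` by a
vector `e` of `W`. By invariance `e` is a self-adjoint central idempotent with `w ∗ e = w` for all
`w` in `W` (`IsBiinvariant.exists_isConvUnit`). So bi-invariant spaces are governed by central
idempotents.

*Every character has a function.* Convolution with an element of `L₁ (K)` is a compact operator on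
`L₁ (K)` (`isCompactOperator_mulRightL`), so the continuous functions fixed by a central element
`z` form a finite-dimensional bi-invariant space (`fixedSpace`). If `σ z = 1`, the Fredholm
alternative shows that this space is nonzero, and applied to `z - e` it shows that the unit `e` of
the space also has `σ e = 1`. For a `z` of this kind with a fixed space of minimal dimension, `e` is
the function of `σ` (`exists_isCharacterFunction`). No continuity of `σ` is needed. The space
fixed by the function of `σ` has no proper bi-invariant subspace, since the unit of such a subspace
is a multiple of the function of `σ` (`eq_fixedSpace_characterFunction`). As the restriction to `G`
is injective and `G` is dense in `G_f`, this gives minimality on `G_f` and on `G`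
(`isMinimalAlmostInvariant_comp`).

*The characters are complete.* Conversely, the centre acts by scalars on a minimal bi-invariant
space, whose unit therefore is the function of a character
(`IsConvUnit.exists_isCharacterFunction`). A function `g` in `L₂` with `g ∗ χ = 0` for the functions
`χ` of all characters is then orthogonal to all finite-dimensional bi-invariant spaces. By the
spectral theorem for compact symmetric operators `g ∗ u = 0` for all self-adjoint central continuous
functions `u`. The bi-invariant metric provides an approximate identity of such functions, whence
`g = 0` (`eq_zero_of_forall_convL2_characterFunction`). The convolutions with the functions of the
characters are mutually orthogonal projections, so that they sum to the identity
(`hasSum_of_symmetric_idempotent`).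
-/

namespace AlmostPeriodic

section CompactGroup

set_option linter.unusedSectionVars false

variable {K : Type*} [Group K] [TopologicalSpace K] [IsTopologicalGroup K] [CompactSpace K]
  [MeasurableSpace K] [BorelSpace K] [SecondCountableTopology K]

/-! ### Integration against a continuous family of vectors -/

section IntegralAgainst

variable {E : Type*} [NormedAddCommGroup E] [NormedSpace ℂ E]

theorem integrable_smul_continuousMap {g : K → ℂ} (hg : Integrable g (haarProb K)) (v : C(K, E)) :
    Integrable (fun y => g y • v y) (haarProb K) := by
  refine (hg.norm.mul_const ‖v‖).mono'
    (hg.aestronglyMeasurable.smul v.continuous.aestronglyMeasurable) ?_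
  refine Filter.Eventually.of_forall fun y => ?_
  rw [norm_smul]
  exact mul_le_mul_of_nonneg_left (v.norm_coe_le_norm y) (norm_nonneg _)

theorem GroupAlgebra.norm_eq_integral (a : GroupAlgebra K) :
    ‖a‖ = ∫ x, ‖a.toFun x‖ ∂haarProb K :=
  L1.norm_eq_integral_norm (μ := haarProb K) a.toLp

/-- The operator `g ↦ ∫ g(y) v(y) dy` from `L₁ (K)` to a Banach space `E`, for a continuous
family `v` of vectors of `E`. -/
noncomputable def integralAgainst (v : C(K, E)) : GroupAlgebra K →L[ℂ] E :=
  LinearMap.mkContinuous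
    { toFun := fun g => ∫ y, g.toFun y • v y ∂haarProb K
      map_add' := fun g h => by
        rw [← integral_add (integrable_smul_continuousMap g.integrable_toFun v)
          (integrable_smul_continuousMap h.integrable_toFun v)]
        refine integral_congr_ae ?_
        filter_upwards [GroupAlgebra.toFun_add g h] with y hy
        rw [hy, Pi.add_apply, add_smul]
      map_smul' := fun c g => by
        rw [RingHom.id_apply, ← integral_smul]
        refine integral_congr_ae ?_
        filter_upwards [GroupAlgebra.toFun_smul c g] with y hy
        rw [hy, Pi.smul_apply, smul_assoc] } ‖v‖ fun g => by
    refine (norm_integral_le_integral_norm _).trans ?_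
    rw [GroupAlgebra.norm_eq_integral, ← integral_const_mul]
    refine integral_mono (integrable_smul_continuousMap g.integrable_toFun v).norm
      (g.integrable_toFun.norm.const_mul _) fun y => ?_
    dsimp only
    rw [norm_smul, mul_comm]
    exact mul_le_mul_of_nonneg_right (v.norm_coe_le_norm y) (norm_nonneg _)

theorem integralAgainst_apply (v : C(K, E)) (g : GroupAlgebra K) :
    integralAgainst v g = ∫ y, g.toFun y • v y ∂haarProb K := rfl

theorem norm_integralAgainst_le (v : C(K, E)) (g : GroupAlgebra K) :
    ‖integralAgainst v g‖ ≤ ‖v‖ * ‖g‖ :=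
  (integralAgainst v).le_of_opNorm_le (LinearMap.mkContinuous_norm_le _ (norm_nonneg v) _) g

/-- A finite-dimensional space that contains every vector of a continuous family contains the
integrals of the family. -/
theorem integralAgainst_mem [CompleteSpace E] (W : Submodule ℂ E) [FiniteDimensional ℂ W]
    {v : C(K, E)} (hv : ∀ y, v y ∈ W) (g : GroupAlgebra K) : integralAgainst v g ∈ W := by
  have : CompleteSpace W := FiniteDimensional.complete ℂ W
  let w : C(K, W) := ⟨fun y => ⟨v y, hv y⟩, by fun_prop⟩
  have h := W.subtypeL.integral_comp_comm (integrable_smul_continuousMap g.integrable_toFun w)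
  have h' : integralAgainst v g = W.subtypeL (∫ y, g.toFun y • w y ∂haarProb K) := by
    rw [← h]; rfl
  rw [h']
  exact Subtype.property _

theorem integralAgainst_eval (v : C(K, C(K, ℂ))) (g : GroupAlgebra K) (x : K) :
    integralAgainst v g x = ∫ y, g.toFun y * v y x ∂haarProb K :=
  ((ContinuousMap.evalCLM ℂ x).integral_comp_comm
    (integrable_smul_continuousMap g.integrable_toFun v)).symm

/-- Integration against a continuous family of continuous functions is a compact operator, by
the Arzelà–Ascoli theorem: a bound for `g` in `L₁` makes the functions `∫ g(y) v(y) dy`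
equicontinuous. -/
theorem isCompactOperator_integralAgainst (v : C(K, C(K, ℂ))) :
    IsCompactOperator (integralAgainst v) := by
  let J : C(K, ℂ) ≃L[ℂ] (K →ᵇ ℂ) :=
    (ContinuousMap.linearIsometryBoundedOfCompact K ℂ ℂ).toContinuousLinearEquiv
  suffices h : IsCompactOperator (J.toContinuousLinearMap ∘L integralAgainst v) by
    have := h.clm_comp J.symm.toContinuousLinearMap
    have e : (⇑J.symm.toContinuousLinearMap ∘ ⇑(J.toContinuousLinearMap ∘L integralAgainst v))
        = integralAgainst v := funext fun g => J.symm_apply_apply _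
    rwa [e] at this
  refine (isCompactOperator_iff_isCompact_closure_image_ball
    (J.toContinuousLinearMap ∘L integralAgainst v : GroupAlgebra K →ₗ[ℂ] (K →ᵇ ℂ))
    one_pos).2 ?_
  refine BoundedContinuousFunction.arzela_ascoli (Metric.closedBall 0 ‖v‖)
    (isCompact_closedBall _ _) _ ?_ ?_
  · rintro _ x ⟨g, hg, rfl⟩
    rw [mem_closedBall_zero_iff]
    rw [mem_ball_zero_iff] at hg
    refine ((integralAgainst v g).norm_coe_le_norm x).trans ?_
    exact (norm_integralAgainst_le v g).trans
      (mul_le_of_le_one_right (norm_nonneg v) hg.le)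
  · -- The modulus of continuity at `x` is that of the transposed family `x ↦ (y ↦ v y x)`.
    let w : C(K, C(K, ℂ)) := ContinuousMap.curry ⟨fun p => v p.2 p.1, by fun_prop⟩
    intro x₀
    rw [Metric.equicontinuousAt_iff_right]
    intro ε hε
    have hw := Metric.tendsto_nhds.1 (w.continuous.tendsto x₀) ε hε
    filter_upwards [hw] with x hx
    rintro ⟨_, g, hg, rfl⟩
    rw [mem_ball_zero_iff] at hg
    change dist (integralAgainst v g x₀) (integralAgainst v g x) < ε
    have e : integralAgainst v g x₀ - integralAgainst v g x = integralAgainst (w x₀ - w x) g := by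
      rw [integralAgainst_eval, integralAgainst_eval, integralAgainst_apply, ← integral_sub]
      · refine integral_congr_ae (Filter.Eventually.of_forall fun y => ?_)
        change _ = g.toFun y * (v y x₀ - v y x)
        rw [mul_sub]
      · exact integrable_smul_continuousMap g.integrable_toFun (w x₀)
      · exact integrable_smul_continuousMap g.integrable_toFun (w x)
    rw [dist_eq_norm, e]
    rw [dist_comm, dist_eq_norm] at hx
    refine ((norm_integralAgainst_le _ g).trans ?_).trans_lt hx
    exact mul_le_of_le_one_right (norm_nonneg _) hg.le

end IntegralAgainst

/-! ### Convolution of integrable with continuous functions -/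

/-- The embedding of the continuous functions into the group algebra. -/
noncomputable def ofContinuous : C(K, ℂ) →L[ℂ] GroupAlgebra K :=
  ContinuousMap.toLp (E := ℂ) 1 (haarProb K) ℂ

theorem toFun_ofContinuous (φ : C(K, ℂ)) : (ofContinuous φ).toFun =ᵐ[haarProb K] φ :=
  ContinuousMap.coeFn_toLp (haarProb K) φ

theorem mk_eq_ofContinuous (φ : C(K, ℂ)) :
    GroupAlgebra.mk φ (integrable_continuousMap φ) = ofContinuous φ :=
  GroupAlgebra.ext_ae ((GroupAlgebra.toFun_mk _ _).trans (toFun_ofContinuous φ).symm)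

theorem ofContinuous_injective : Function.Injective (ofContinuous : C(K, ℂ) → GroupAlgebra K) :=
  ContinuousMap.toLp_injective (haarProb K)

theorem denseRange_ofContinuous [T2Space K] :
    DenseRange (ofContinuous : C(K, ℂ) → GroupAlgebra K) :=
  ContinuousMap.toLp_denseRange ℂ (haarProb K) ℂ ENNReal.one_ne_top

/-- The left translates `x ↦ φ (y⁻¹ x)` of a continuous function, as a continuous family. -/
noncomputable def leftFamily (φ : C(K, ℂ)) : C(K, C(K, ℂ)) :=
  ContinuousMap.curry ⟨fun p => φ (p.1⁻¹ * p.2), by fun_prop⟩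

/-- The right translates `x ↦ φ (x y⁻¹)` of a continuous function, as a continuous family. -/
noncomputable def rightFamily (φ : C(K, ℂ)) : C(K, C(K, ℂ)) :=
  ContinuousMap.curry ⟨fun p => φ (p.2 * p.1⁻¹), by fun_prop⟩

/-- The operator `g ↦ g ∗ φ` from `L₁ (K)` to `C (K)`, for a continuous function `φ`. -/
noncomputable def convRight (φ : C(K, ℂ)) : GroupAlgebra K →L[ℂ] C(K, ℂ) :=
  integralAgainst (leftFamily φ)

/-- The operator `g ↦ φ ∗ g` from `L₁ (K)` to `C (K)`, for a continuous function `φ`. -/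
noncomputable def convLeft (φ : C(K, ℂ)) : GroupAlgebra K →L[ℂ] C(K, ℂ) :=
  integralAgainst (rightFamily φ)

theorem convRight_apply (φ : C(K, ℂ)) (g : GroupAlgebra K) (x : K) :
    convRight φ g x = conv g.toFun φ x :=
  integralAgainst_eval _ _ _

theorem conv_eq_integral_inv (f g : K → ℂ) (x : K) :
    conv f g x = ∫ y, g y * f (x * y⁻¹) ∂haarProb K := by
  rw [conv, ← integral_div_left_eq_self (fun y => f y * g (y⁻¹ * x)) (haarProb K) x]
  refine integral_congr_ae (Filter.Eventually.of_forall fun y => ?_)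
  simp [div_eq_mul_inv, mul_comm]

theorem convLeft_apply (φ : C(K, ℂ)) (g : GroupAlgebra K) (x : K) :
    convLeft φ g x = conv φ g.toFun x :=
  (integralAgainst_eval _ _ _).trans (conv_eq_integral_inv _ _ _).symm

theorem ofContinuous_convRight (φ : C(K, ℂ)) (g : GroupAlgebra K) :
    ofContinuous (convRight φ g) = g * ofContinuous φ := by
  refine GroupAlgebra.ext_ae ((toFun_ofContinuous _).trans ?_)
  refine Filter.EventuallyEq.trans ?_ (GroupAlgebra.toFun_mul _ _).symm
  rw [conv_congr (Filter.EventuallyEq.refl _ _) (toFun_ofContinuous φ)]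
  exact Filter.Eventually.of_forall fun x => convRight_apply φ g x

theorem ofContinuous_convLeft (φ : C(K, ℂ)) (g : GroupAlgebra K) :
    ofContinuous (convLeft φ g) = ofContinuous φ * g := by
  refine GroupAlgebra.ext_ae ((toFun_ofContinuous _).trans ?_)
  refine Filter.EventuallyEq.trans ?_ (GroupAlgebra.toFun_mul _ _).symm
  rw [conv_congr (toFun_ofContinuous φ) (Filter.EventuallyEq.refl _ _)]
  exact Filter.Eventually.of_forall fun x => convLeft_apply φ g x

theorem convLeft_ofContinuous_apply (φ ψ : C(K, ℂ)) (x : K) :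
    convLeft φ (ofContinuous ψ) x = conv φ ψ x := by
  rw [convLeft_apply, conv_congr (Filter.EventuallyEq.refl _ _) (toFun_ofContinuous ψ)]

theorem ofContinuous_mul_eq_iff (φ ψ χ : C(K, ℂ)) :
    ofContinuous φ * ofContinuous ψ = ofContinuous χ ↔ conv φ ψ = χ := by
  rw [← ofContinuous_convLeft, ofContinuous_injective.eq_iff, DFunLike.ext_iff, funext_iff]
  simp only [convLeft_ofContinuous_apply]

/-- The involution `φ ↦ φ̃` on continuous functions. -/
noncomputable def involMap (φ : C(K, ℂ)) : C(K, ℂ) := ⟨invol φ, by unfold invol; fun_prop⟩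

theorem coe_involMap (φ : C(K, ℂ)) : ⇑(involMap φ) = invol φ := rfl

theorem invol_invol (f : K → ℂ) : invol (invol f) = f := by
  funext x
  simp [invol]

theorem ofContinuous_involMap (φ : C(K, ℂ)) : ofContinuous (involMap φ) = star (ofContinuous φ) :=
  GroupAlgebra.ext_ae <| (toFun_ofContinuous _).trans
    ((GroupAlgebra.toFun_star _).trans (invol_congr (toFun_ofContinuous φ))).symm

/-! ### Multiplication operators on the group algebra -/

theorem GroupAlgebra.norm_mul_le (a b : GroupAlgebra K) : ‖a * b‖ ≤ ‖a‖ * ‖b‖ := by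
  have hint := integrable_conv_prod a.integrable_toFun b.integrable_toFun
  have hswap := hint.norm.swap
  calc ‖a * b‖ = ∫ x, ‖conv a.toFun b.toFun x‖ ∂haarProb K := by
        rw [norm_eq_integral]
        refine integral_congr_ae ?_
        filter_upwards [toFun_mul a b] with x hx
        rw [hx]
    _ ≤ ∫ x, ∫ y, ‖a.toFun y * b.toFun (y⁻¹ * x)‖ ∂haarProb K ∂haarProb K :=
        integral_mono_of_nonneg (Filter.Eventually.of_forall fun _ => norm_nonneg _)
          hswap.integral_prod_left
          (Filter.Eventually.of_forall fun x => norm_integral_le_integral_norm _)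
    _ = ∫ y, ∫ x, ‖a.toFun y * b.toFun (y⁻¹ * x)‖ ∂haarProb K ∂haarProb K :=
        integral_integral_swap hswap
    _ = ‖a‖ * ‖b‖ := by
        simp only [norm_mul, integral_const_mul]
        have h (y : K) : ∫ x, ‖b.toFun (y⁻¹ * x)‖ ∂haarProb K = ‖b‖ := by
          rw [integral_mul_left_eq_self (fun x => ‖b.toFun x‖) y⁻¹, norm_eq_integral]
        simp only [h, integral_mul_const, norm_eq_integral]

/-- Multiplication of the group algebra as a continuous bilinear map, with the right factor as
first argument. -/
noncomputable def mulRightL : GroupAlgebra K →L[ℂ] GroupAlgebra K →L[ℂ] GroupAlgebra K :=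
  LinearMap.mkContinuous₂ (LinearMap.mul ℂ (GroupAlgebra K)).flip 1 fun a b => by
    rw [one_mul, mul_comm]
    exact GroupAlgebra.norm_mul_le b a

/-- Multiplication by an element of the group algebra is compact: this is so for continuous
functions, which are dense. -/
theorem isCompactOperator_mulRightL [T2Space K] (z : GroupAlgebra K) :
    IsCompactOperator (mulRightL z) := by
  refine denseRange_ofContinuous.induction_on (p := fun z => IsCompactOperator (mulRightL z)) z
    ?_ fun φ => ?_
  · exact isClosed_setOfPred_isCompactOperator.preimage mulRightL.continuous
  · have h := (isCompactOperator_integralAgainst (leftFamily φ)).clm_comp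
      (ofContinuous : C(K, ℂ) →L[ℂ] GroupAlgebra K)
    have e : ⇑(ofContinuous : C(K, ℂ) →L[ℂ] GroupAlgebra K) ∘ ⇑(integralAgainst (leftFamily φ))
        = mulRightL (ofContinuous φ) := funext fun g => ofContinuous_convRight φ g
    rwa [e] at h

/-! ### Bi-invariant spaces of continuous functions -/

/-- A space of continuous functions is bi-invariant if it is closed under left and right
translations. -/
def IsBiinvariant (W : Submodule ℂ C(K, ℂ)) : Prop :=
  ∀ w ∈ W, ∀ s : K, w.comp (ContinuousMap.mulLeft s) ∈ W ∧ w.comp (ContinuousMap.mulRight s) ∈ W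

theorem IsBiinvariant.convRight_mem {W : Submodule ℂ C(K, ℂ)} [FiniteDimensional ℂ W]
    (hW : IsBiinvariant W) {w : C(K, ℂ)} (hw : w ∈ W) (g : GroupAlgebra K) : convRight w g ∈ W :=
  integralAgainst_mem W (fun y => (hW w hw y⁻¹).1) g

theorem IsBiinvariant.convLeft_mem {W : Submodule ℂ C(K, ℂ)} [FiniteDimensional ℂ W]
    (hW : IsBiinvariant W) {w : C(K, ℂ)} (hw : w ∈ W) (g : GroupAlgebra K) : convLeft w g ∈ W :=
  integralAgainst_mem W (fun y => (hW w hw y⁻¹).2) g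

/-- The convolution unit of a bi-invariant space of continuous functions: a self-adjoint central
idempotent in the space that acts on the space as the identity. -/
structure IsConvUnit (W : Submodule ℂ C(K, ℂ)) (e : C(K, ℂ)) : Prop where
  mem : e ∈ W
  invol_eq : invol e = e
  mem_center : ofContinuous e ∈ groupCenter K
  mul_eq : ∀ w ∈ W, ofContinuous w * ofContinuous e = ofContinuous w

/-- On a finite-dimensional space of continuous functions, evaluation at the identity is
represented by a vector of the space. -/
theorem exists_apply_one_eq_integral (W : Submodule ℂ C(K, ℂ)) [FiniteDimensional ℂ W] :
    ∃ e ∈ W, ∀ w ∈ W, w 1 = ∫ y, w y * star (e y) ∂haarProb K := by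
  let ι : C(K, ℂ) →ₗ[ℂ] Lp ℂ 2 (haarProb K) :=
    (ContinuousMap.toLp (E := ℂ) 2 (haarProb K) ℂ : C(K, ℂ) →L[ℂ] Lp ℂ 2 (haarProb K))
  have hι : Function.Injective ι := ContinuousMap.toLp_injective (haarProb K)
  let Φ := Submodule.equivMapOfInjective ι hι W
  have : FiniteDimensional ℂ (W.map ι) := inferInstance
  have : CompleteSpace (W.map ι) := FiniteDimensional.complete ℂ _
  let ℓ : W.map ι →ₗ[ℂ] ℂ :=
    ((ContinuousMap.evalCLM ℂ (1 : K) : C(K, ℂ) →L[ℂ] ℂ) : C(K, ℂ) →ₗ[ℂ] ℂ) ∘ₗ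
      W.subtype ∘ₗ Φ.symm.toLinearMap
  let v := (InnerProductSpace.toDual ℂ (W.map ι)).symm (LinearMap.toContinuousLinearMap ℓ)
  refine ⟨Φ.symm v, (Φ.symm v).2, fun w hw => ?_⟩
  have h : inner ℂ v (Φ ⟨w, hw⟩) = ℓ (Φ ⟨w, hw⟩) := InnerProductSpace.toDual_symm_apply
  have h1 : ℓ (Φ ⟨w, hw⟩) = w 1 := by
    change (W.subtype (Φ.symm (Φ ⟨w, hw⟩))) 1 = w 1
    rw [LinearEquiv.symm_apply_apply]; rfl
  have h2 : inner ℂ v (Φ ⟨w, hw⟩) = inner ℂ (ι (Φ.symm v)) (ι w) := by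
    have : (v : Lp ℂ 2 (haarProb K)) = ι (Φ.symm v) := by
      conv_lhs => rw [← Φ.apply_symm_apply v]
      rfl
    rw [← this]; rfl
  rw [← h1, ← h, h2]
  exact ContinuousMap.inner_toLp (haarProb K) _ _

/-- A finite-dimensional bi-invariant space of continuous functions has a convolution unit, namely
the vector that represents evaluation at the identity. -/
theorem IsBiinvariant.exists_isConvUnit {W : Submodule ℂ C(K, ℂ)} [FiniteDimensional ℂ W]
    (hW : IsBiinvariant W) : ∃ e, IsConvUnit W e := by
  obtain ⟨e, heW, he⟩ := exists_apply_one_eq_integral W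
  let e' : C(K, ℂ) := involMap e
  have hR (w : C(K, ℂ)) (hw : w ∈ W) : conv w e' = w := by
    funext x
    have h := he _ (hW w hw x).1
    simp only [ContinuousMap.comp_apply, ContinuousMap.coe_mulLeft, mul_one] at h
    rw [h, conv, ← integral_mul_left_eq_self _ x]
    simp [e', coe_involMap, invol]
  have hL (w : C(K, ℂ)) (hw : w ∈ W) : conv e' w = w := by
    funext x
    have h := he _ (hW w hw x).2
    simp only [ContinuousMap.comp_apply, ContinuousMap.coe_mulRight, one_mul] at h
    rw [h, conv, ← integral_inv_eq_self _ (haarProb K)]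
    simp [e', coe_involMap, invol, mul_comm]
  have hinv : invol (e' : K → ℂ) = e := invol_invol e
  have hee : e' = e := by
    have h := congrArg invol (hR e heW)
    rw [invol_conv, hinv] at h
    exact DFunLike.coe_injective (h.symm.trans (hR e heW))
  rw [hee] at hR hL
  have hR' (w : C(K, ℂ)) (hw : w ∈ W) : ofContinuous w * ofContinuous e = ofContinuous w :=
    (ofContinuous_mul_eq_iff _ _ _).2 (hR w hw)
  have hL' (w : C(K, ℂ)) (hw : w ∈ W) : ofContinuous e * ofContinuous w = ofContinuous w :=
    (ofContinuous_mul_eq_iff _ _ _).2 (hL w hw)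
  refine ⟨e, heW, by rw [hee] at hinv; exact hinv,
    NonUnitalStarSubalgebra.mem_center_iff.2 fun g => ?_, hR'⟩
  -- Both `g ∗ e` and `e ∗ g` lie in `W`, on which `e` acts as a two-sided unit.
  have h1 := hL' _ (hW.convRight_mem heW g)
  have h2 := hR' _ (hW.convLeft_mem heW g)
  rw [ofContinuous_convRight] at h1
  rw [ofContinuous_convLeft] at h2
  rw [← h1, ← mul_assoc, h2]

theorem mul_comm_of_mem_center {z : GroupAlgebra K} (hz : z ∈ groupCenter K)
    (g : GroupAlgebra K) : g * z = z * g :=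
  NonUnitalStarSubalgebra.mem_center_iff.1 hz g

theorem IsConvUnit.star_eq {W : Submodule ℂ C(K, ℂ)} {e : C(K, ℂ)} (he : IsConvUnit W e) :
    star (ofContinuous e) = ofContinuous e := by
  rw [← ofContinuous_involMap]
  exact congrArg _ (DFunLike.coe_injective he.invol_eq)

theorem IsConvUnit.mul_self {W : Submodule ℂ C(K, ℂ)} {e : C(K, ℂ)} (he : IsConvUnit W e) :
    ofContinuous e * ofContinuous e = ofContinuous e := he.mul_eq e he.mem

theorem IsConvUnit.ne_zero {W : Submodule ℂ C(K, ℂ)} {e : C(K, ℂ)} (he : IsConvUnit W e)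
    (hW : W ≠ ⊥) : e ≠ 0 := by
  rintro rfl
  refine hW ((Submodule.eq_bot_iff _).2 fun w hw => ofContinuous_injective ?_)
  have := he.mul_eq w hw
  rw [map_zero, mul_zero] at this
  rw [map_zero, this]

/-! ### Eigenspaces of central elements -/

/-- The space of the continuous functions that are fixed by convolution with `z`. -/
noncomputable def fixedSpace (z : GroupAlgebra K) : Submodule ℂ C(K, ℂ) :=
  LinearMap.eqLocus
    ((mulRightL z ∘L ofContinuous : C(K, ℂ) →L[ℂ] GroupAlgebra K) : C(K, ℂ) →ₗ[ℂ] GroupAlgebra K)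
    ((ofContinuous : C(K, ℂ) →L[ℂ] GroupAlgebra K) : C(K, ℂ) →ₗ[ℂ] GroupAlgebra K)

theorem mem_fixedSpace {z : GroupAlgebra K} {h : C(K, ℂ)} :
    h ∈ fixedSpace z ↔ ofContinuous h * z = ofContinuous h := Iff.rfl

theorem convLeft_comp_mulLeft (h : C(K, ℂ)) (g : GroupAlgebra K) (s : K) :
    convLeft (h.comp (ContinuousMap.mulLeft s)) g =
      (convLeft h g).comp (ContinuousMap.mulLeft s) := by
  ext x
  simp [convLeft_apply, conv_eq_integral_inv, mul_assoc]

theorem convRight_comp_mulRight (h : C(K, ℂ)) (g : GroupAlgebra K) (s : K) :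
    convRight (h.comp (ContinuousMap.mulRight s)) g =
      (convRight h g).comp (ContinuousMap.mulRight s) := by
  ext x
  simp [convRight_apply, conv, mul_assoc]

theorem isBiinvariant_fixedSpace {z : GroupAlgebra K} (hz : z ∈ groupCenter K) :
    IsBiinvariant (fixedSpace z) := by
  intro h hh s
  rw [mem_fixedSpace, ← ofContinuous_convLeft, ofContinuous_injective.eq_iff] at hh
  rw [mem_fixedSpace, mem_fixedSpace]
  refine ⟨?_, ?_⟩
  · rw [← ofContinuous_convLeft, convLeft_comp_mulLeft, hh]
  · have hh' : convRight h z = h := by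
      apply ofContinuous_injective
      rw [ofContinuous_convRight, ← mul_comm_of_mem_center hz, ← ofContinuous_convLeft, hh]
    rw [mul_comm_of_mem_center hz, ← ofContinuous_convRight, convRight_comp_mulRight, hh']

/-- The eigenspace of a compact operator for a nonzero eigenvalue is finite-dimensional. -/
theorem _root_.IsCompactOperator.finiteDimensional_eigenspace {X : Type*} [NormedAddCommGroup X]
    [NormedSpace ℂ X] [CompleteSpace X] {T : X →L[ℂ] X} (hT : IsCompactOperator T) {μ : ℂ}
    (hμ : μ ≠ 0) :
    FiniteDimensional ℂ (Module.End.eigenspace (T : Module.End ℂ X) μ) := by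
  replace hT := hT.restrict' ((Module.End.mem_invtSubmodule_iff_forall_mem_of_mem _).mp
    (Module.End.eigenspace_mem_invtSubmodule T.toLinearMap μ))
  rw [Module.End.restrict_eigenspace, LinearMap.coe_smul, IsCompactOperator.smul_iff₀ hμ] at hT
  rwa [← isCompactOperator_id_iff_finiteDimensional]

instance [T2Space K] (z : GroupAlgebra K) : FiniteDimensional ℂ (fixedSpace z) := by
  have := (isCompactOperator_mulRightL z).finiteDimensional_eigenspace one_ne_zero
  refine FiniteDimensional.of_injective (LinearMap.restrict (q := Module.End.eigenspace
    (mulRightL z : Module.End ℂ (GroupAlgebra K)) 1)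
    ((ofContinuous : C(K, ℂ) →L[ℂ] GroupAlgebra K) : C(K, ℂ) →ₗ[ℂ] GroupAlgebra K)
    fun h hh => ?_) fun a b hab => ?_
  · rw [Module.End.mem_eigenspace_iff, one_smul]
    exact mem_fixedSpace.1 hh
  · exact Subtype.ext (ofContinuous_injective (congrArg Subtype.val hab))

/-! ### The continuous function of a character -/

/-- A central element on which a character takes the value `1` fixes a nonzero element of the
group algebra. Otherwise the Fredholm alternative gives an element `w` with `w - w ∗ z = z`,
which is central because the solution is unique, and the character maps this equation to
`0 = 1`. -/
theorem exists_mul_eq_self [T2Space K] (σ : groupCenter K →⋆ₙₐ[ℂ] ℂ) {z : groupCenter K}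
    (hz : σ z = 1) : ∃ g : GroupAlgebra K, g ≠ 0 ∧ g * z = g := by
  rcases (isCompactOperator_mulRightL (z : GroupAlgebra K)).hasEigenvalue_or_mem_resolventSet
    (one_ne_zero (α := ℂ)) with h | h
  · obtain ⟨g, hg⟩ := h.exists_hasEigenvector
    exact ⟨g, hg.2, hg.apply_eq_smul.trans (one_smul ℂ g)⟩
  · exfalso
    rw [spectrum.mem_resolventSet_iff, ContinuousLinearMap.isUnit_iff_bijective, map_one] at h
    have happ (g : GroupAlgebra K) :
        (1 - mulRightL (z : GroupAlgebra K) : GroupAlgebra K →L[ℂ] GroupAlgebra K) g = g - g * z :=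
      rfl
    obtain ⟨w, hw⟩ := h.2 (z : GroupAlgebra K)
    rw [happ] at hw
    have hcomm := mul_comm_of_mem_center z.2
    have hwc : w ∈ groupCenter K := by
      refine NonUnitalStarSubalgebra.mem_center_iff.2 fun g => h.1 ?_
      rw [happ, happ, mul_assoc, mul_assoc w, hcomm g, ← mul_assoc w, ← mul_sub, ← sub_mul, hw,
        hcomm g]
    have hw' : (⟨w, hwc⟩ : groupCenter K) = z + ⟨w, hwc⟩ * z :=
      Subtype.ext (sub_eq_iff_eq_add.1 hw)
    have := congrArg σ hw'
    rw [map_add, map_mul, hz, mul_one] at this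
    exact one_ne_zero (right_eq_add.1 this)

theorem fixedSpace_ne_bot [T2Space K] (σ : groupCenter K →⋆ₙₐ[ℂ] ℂ) {z : groupCenter K}
    (hz : σ z = 1) : fixedSpace (z : GroupAlgebra K) ≠ ⊥ := by
  obtain ⟨g, hg0, hg⟩ := exists_mul_eq_self σ hz
  intro hbot
  -- The continuous functions `g ∗ φ` are fixed by `z`, and approximate `g = g ∗ z`.
  have h0 (φ : C(K, ℂ)) : g * ofContinuous φ = 0 := by
    have hmem : convRight φ g ∈ fixedSpace (z : GroupAlgebra K) := by
      rw [mem_fixedSpace, ofContinuous_convRight, mul_assoc, mul_comm_of_mem_center z.2,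
        ← mul_assoc, hg]
    rw [hbot, Submodule.mem_bot] at hmem
    rw [← ofContinuous_convRight, hmem, map_zero]
  refine hg0 (hg ▸ ?_)
  refine denseRange_ofContinuous.induction_on (p := fun a => g * a = 0) (z : GroupAlgebra K)
    (isClosed_eq ?_ continuous_const) h0
  exact (mulRightL (K := K)).continuous.clm_apply continuous_const

/-- The convolution unit of the space fixed by `z` has the value `1` under every character `σ`
with `σ z = 1`. Otherwise its value is `0`, so that `σ` takes the value `1` on `z - e`, which
fixes only zero. -/
theorem apply_isConvUnit_fixedSpace [T2Space K] (σ : groupCenter K →⋆ₙₐ[ℂ] ℂ)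
    {z : groupCenter K} (hz : σ z = 1) {e : C(K, ℂ)}
    (he : IsConvUnit (fixedSpace (z : GroupAlgebra K)) e) :
    σ ⟨ofContinuous e, he.mem_center⟩ = 1 := by
  set c : groupCenter K := ⟨ofContinuous e, he.mem_center⟩
  have hcc : c * c = c := Subtype.ext he.mul_self
  have hσ : σ c * σ c = σ c := by rw [← map_mul, hcc]
  by_contra h1
  have h0 : σ c = 0 := by
    by_contra h0
    exact h1 (mul_right_cancel₀ h0 (hσ.trans (one_mul _).symm))
  have hz' : σ (z + (-1 : ℂ) • c) = 1 := by rw [map_add, map_smul, hz, h0, smul_zero, add_zero]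
  obtain ⟨h, hh, hne⟩ := Submodule.exists_mem_ne_zero_of_ne_bot (fixedSpace_ne_bot σ hz')
  refine hne ?_
  rw [mem_fixedSpace] at hh
  have hez : (z : GroupAlgebra K) * ofContinuous e = ofContinuous e := by
    rw [← mul_comm_of_mem_center z.2]; exact mem_fixedSpace.1 he.mem
  have hc : ((z + (-1 : ℂ) • c : groupCenter K) : GroupAlgebra K) = z - ofContinuous e := by
    change (z : GroupAlgebra K) + (-1 : ℂ) • ofContinuous e = _
    rw [neg_one_smul, sub_eq_add_neg]
  rw [hc] at hh
  have he0 : ofContinuous h * ofContinuous e = 0 := by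
    rw [← hh, mul_assoc, sub_mul, hez, he.mul_self, sub_self, mul_zero]
  have hmem : h ∈ fixedSpace (z : GroupAlgebra K) := by
    rw [mem_fixedSpace]
    rw [mul_sub, he0, sub_zero] at hh
    exact hh
  apply ofContinuous_injective
  rw [← he.mul_eq h hmem, he0, map_zero]

theorem isCharacterFunction_iff {σ : Character K} {χ : C(K, ℂ)} :
    IsCharacterFunction σ χ ↔ ∃ h : ofContinuous χ ∈ groupCenter K,
      (∀ z : groupCenter K, (z : GroupAlgebra K) * ofContinuous χ = σ.1 z • ofContinuous χ) ∧
        σ.1 ⟨_, h⟩ = 1 := by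
  unfold IsCharacterFunction
  simp only [mk_eq_ofContinuous]

/-- Among the spaces fixed by the central elements on which `σ` takes the value `1`, one of
minimal dimension has a convolution unit that is the function of `σ`. -/
theorem exists_isCharacterFunction [T2Space K] (σ : Character K) :
    ∃ χ, IsCharacterFunction σ χ := by
  have hne : ∃ z : groupCenter K, σ.1 z = 1 := by
    obtain ⟨z, hz⟩ := DFunLike.ne_iff.1 σ.2
    exact ⟨(σ.1 z)⁻¹ • z, by rw [map_smul, smul_eq_mul]; exact inv_mul_cancel₀ hz⟩
  let S : Set (groupCenter K) := {z | σ.1 z = 1}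
  let d : groupCenter K → ℕ := fun z => Module.finrank ℂ (fixedSpace (z : GroupAlgebra K))
  obtain ⟨z, hz, hmin⟩ : ∃ z ∈ S, ∀ y ∈ S, d z ≤ d y := by
    obtain ⟨z, hz⟩ := hne
    exact ⟨Function.argminOn d S ⟨z, hz⟩, Function.argminOn_mem _ _ _,
      fun y hy => Function.argminOn_le _ _ hy⟩
  obtain ⟨e, he⟩ := (isBiinvariant_fixedSpace z.2).exists_isConvUnit
  have hσe := apply_isConvUnit_fixedSpace σ.1 hz he
  set c : groupCenter K := ⟨ofContinuous e, he.mem_center⟩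
  have hez : ofContinuous e * z = ofContinuous e := mem_fixedSpace.1 he.mem
  have key (y : groupCenter K) (hy : σ.1 y = 1) : ofContinuous e * y = ofContinuous e := by
    have hcy : σ.1 (c * y) = 1 := by rw [map_mul, hσe, hy, one_mul]
    have hle : fixedSpace ((c * y : groupCenter K) : GroupAlgebra K) ≤
        fixedSpace (z : GroupAlgebra K) := fun h hh => by
      rw [mem_fixedSpace] at hh ⊢
      have hcy' : ((c * y : groupCenter K) : GroupAlgebra K) = ofContinuous e * y := rfl
      rw [hcy'] at hh
      rw [← hh, mul_assoc, mul_comm_of_mem_center z.2, ← mul_assoc (z : GroupAlgebra K),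
        ← mul_comm_of_mem_center z.2, hez]
    have heq := Submodule.eq_of_le_of_finrank_le hle (hmin _ hcy)
    have hmem := he.mem
    rw [← heq, mem_fixedSpace] at hmem
    change ofContinuous e * (ofContinuous e * (y : GroupAlgebra K)) = _ at hmem
    rwa [← mul_assoc, he.mul_self] at hmem
  refine ⟨e, isCharacterFunction_iff.2 ⟨he.mem_center, fun y => ?_, hσe⟩⟩
  -- Adding a multiple of `e` brings the value of `σ` to `1`.
  have h1 : σ.1 (y + (1 - σ.1 y) • c) = 1 := by
    rw [map_add, map_smul, hσe, smul_eq_mul]; ring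
  have h2 := key _ h1
  change ofContinuous e * ((y : GroupAlgebra K) + (1 - σ.1 y) • ofContinuous e) = _ at h2
  rw [mul_add, mul_smul_comm, he.mul_self, sub_smul, one_smul] at h2
  rw [← mul_comm_of_mem_center y.2]
  have h3 := sub_eq_zero.2 h2
  rw [← sub_eq_zero, ← h3]
  abel

theorem IsCharacterFunction.unique {σ : Character K} {χ ψ : C(K, ℂ)}
    (hχ : IsCharacterFunction σ χ) (hψ : IsCharacterFunction σ ψ) : χ = ψ := by
  obtain ⟨hc, h1, h2⟩ := isCharacterFunction_iff.1 hχ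
  obtain ⟨hc', h1', h2'⟩ := isCharacterFunction_iff.1 hψ
  have e1 := h1 ⟨_, hc'⟩
  have e2 := h1' ⟨_, hc⟩
  rw [h2', one_smul] at e1
  rw [h2, one_smul] at e2
  apply ofContinuous_injective
  rw [← e1, mul_comm_of_mem_center hc, e2]

/-- The function of the character `σ`. -/
noncomputable def characterFunction [T2Space K] (σ : Character K) : C(K, ℂ) :=
  (exists_isCharacterFunction σ).choose

theorem isCharacterFunction_characterFunction [T2Space K] (σ : Character K) :
    IsCharacterFunction σ (characterFunction σ) :=
  (exists_isCharacterFunction σ).choose_spec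

section

variable [T2Space K] (σ : Character K)

theorem characterFunction_mem_center : ofContinuous (characterFunction σ) ∈ groupCenter K :=
  (isCharacterFunction_iff.1 (isCharacterFunction_characterFunction σ)).1

theorem mul_characterFunction (z : groupCenter K) :
    (z : GroupAlgebra K) * ofContinuous (characterFunction σ) =
      σ.1 z • ofContinuous (characterFunction σ) :=
  (isCharacterFunction_iff.1 (isCharacterFunction_characterFunction σ)).2.1 z

theorem apply_characterFunction :
    σ.1 ⟨_, characterFunction_mem_center σ⟩ = 1 :=
  (isCharacterFunction_iff.1 (isCharacterFunction_characterFunction σ)).2.2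

theorem characterFunction_mul_self :
    ofContinuous (characterFunction σ) * ofContinuous (characterFunction σ) =
      ofContinuous (characterFunction σ) := by
  have h := mul_characterFunction σ ⟨_, characterFunction_mem_center σ⟩
  rwa [apply_characterFunction, one_smul] at h

theorem characterFunction_mul_of_ne {σ τ : Character K} (h : σ ≠ τ) :
    ofContinuous (characterFunction σ) * ofContinuous (characterFunction τ) = 0 := by
  by_contra hne
  refine h (Subtype.ext (DFunLike.ext _ _ fun z => ?_))
  have h1 := congrArg (· * ofContinuous (characterFunction τ)) (mul_characterFunction σ z)
  have h2 := congrArg (ofContinuous (characterFunction σ) * ·) (mul_characterFunction τ z)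
  beta_reduce at h1 h2
  rw [smul_mul_assoc] at h1
  rw [mul_smul_comm, ← mul_assoc, mul_comm_of_mem_center z.2, h1] at h2
  exact smul_left_injective ℂ hne h2

theorem invol_characterFunction : invol (characterFunction σ) = characterFunction σ := by
  -- The involution of `χ` has the two properties that characterize `χ`.
  let ψ : C(K, ℂ) := involMap (characterFunction σ)
  let c : groupCenter K := ⟨_, characterFunction_mem_center σ⟩
  have hψ : ofContinuous ψ = star (ofContinuous (characterFunction σ)) :=
    ofContinuous_involMap _
  have hmem : ofContinuous ψ ∈ groupCenter K := hψ ▸ (star c).2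
  have hc : (⟨_, hmem⟩ : groupCenter K) = star c := Subtype.ext hψ
  have : IsCharacterFunction σ ψ := by
    refine isCharacterFunction_iff.2 ⟨hmem, fun z => ?_, ?_⟩
    · have h := congrArg star (mul_characterFunction σ (star z))
      rw [star_smul, star_mul, map_star, star_star, ← hψ] at h
      rw [← mul_comm_of_mem_center z.2, ← h]
      congr 1
      exact (star_star (z : GroupAlgebra K)).symm
    · rw [hc, map_star, apply_characterFunction, star_one]
  have h := this.unique (isCharacterFunction_characterFunction σ)
  exact congrArg DFunLike.coe h

/-- The space fixed by the function of a character is a minimal bi-invariant space: the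
convolution unit of a bi-invariant subspace is a multiple of the function of the character. -/
theorem eq_fixedSpace_characterFunction {W : Submodule ℂ C(K, ℂ)} (hW : IsBiinvariant W)
    (hle : W ≤ fixedSpace (ofContinuous (characterFunction σ))) (hne : W ≠ ⊥) :
    W = fixedSpace (ofContinuous (characterFunction σ)) := by
  have : FiniteDimensional ℂ W := Submodule.finiteDimensional_of_le hle
  obtain ⟨e, he⟩ := hW.exists_isConvUnit
  have h1 := mul_characterFunction σ ⟨_, he.mem_center⟩
  have h2 : ofContinuous e * ofContinuous (characterFunction σ) = ofContinuous e := hle he.mem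
  set a := σ.1 ⟨_, he.mem_center⟩
  have h3 : e = a • characterFunction σ :=
    ofContinuous_injective (by rw [map_smul]; exact h2.symm.trans h1)
  have ha : a ≠ 0 := by
    rintro ha
    rw [ha, zero_smul] at h3
    exact he.ne_zero hne h3
  have hχ : characterFunction σ ∈ W := by
    have := W.smul_mem a⁻¹ he.mem
    rwa [h3, inv_smul_smul₀ ha] at this
  refine le_antisymm hle fun w hw => ?_
  have := hW.convRight_mem hχ (ofContinuous w)
  have hw' : convRight (characterFunction σ) (ofContinuous w) = w :=
    ofContinuous_injective ((ofContinuous_convRight _ _).trans hw)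
  rwa [hw'] at this

end

/-! ### Minimal bi-invariant spaces -/

/-- On a minimal bi-invariant space with unit `e`, a central element acts as a scalar, as it has
an eigenvalue there and the eigenspace is bi-invariant. -/
theorem IsConvUnit.exists_mul_eq_smul [T2Space K] {W : Submodule ℂ C(K, ℂ)}
    [FiniteDimensional ℂ W] (hW : IsBiinvariant W) (hne : W ≠ ⊥)
    (hmin : ∀ U ≤ W, IsBiinvariant U → U ≠ ⊥ → U = W) {e : C(K, ℂ)} (he : IsConvUnit W e)
    (z : groupCenter K) :
    ∃ c : ℂ, (z : GroupAlgebra K) * ofContinuous e = c • ofContinuous e := by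
  have : Nontrivial W := Submodule.nontrivial_iff_ne_bot.2 hne
  let T : W →ₗ[ℂ] W :=
    { toFun := fun w => ⟨convLeft (w : C(K, ℂ)) (z : GroupAlgebra K), hW.convLeft_mem w.2 _⟩
      map_add' := fun v w => Subtype.ext <| ofContinuous_injective <| by
        simp only [Submodule.coe_add, map_add, ofContinuous_convLeft, add_mul]
      map_smul' := fun c w => Subtype.ext <| ofContinuous_injective <| by
        simp only [Submodule.coe_smul, map_smul, ofContinuous_convLeft, smul_mul_assoc,
          RingHom.id_apply] }
  obtain ⟨c, hc⟩ := Module.End.exists_eigenvalue T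
  obtain ⟨w, hw⟩ := hc.exists_hasEigenvector
  have hwz : ofContinuous (w : C(K, ℂ)) * (z : GroupAlgebra K) =
      c • ofContinuous (w : C(K, ℂ)) := by
    have h := congrArg (fun v : W => ofContinuous (v : C(K, ℂ))) hw.apply_eq_smul
    beta_reduce at h
    rw [Submodule.coe_smul, map_smul] at h
    rw [← h, ← ofContinuous_convLeft]
    rfl
  -- On `W`, being fixed by `y` means being an eigenvector of `z` for the eigenvalue `c`.
  let y : groupCenter K := z + (1 - c) • ⟨ofContinuous e, he.mem_center⟩
  have hy (v : C(K, ℂ)) (hv : v ∈ W) : v ∈ fixedSpace (y : GroupAlgebra K) ↔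
      ofContinuous v * (z : GroupAlgebra K) = c • ofContinuous v := by
    rw [mem_fixedSpace]
    change ofContinuous v * ((z : GroupAlgebra K) + (1 - c) • ofContinuous e) = _ ↔ _
    rw [mul_add, mul_smul_comm, he.mul_eq v hv, sub_smul, one_smul, ← sub_eq_zero,
      ← sub_eq_zero (b := c • _)]
    refine Eq.congr ?_ rfl
    abel
  have hU := hmin (W ⊓ fixedSpace (y : GroupAlgebra K)) inf_le_left
    (fun v hv s => ⟨⟨(hW v hv.1 s).1, (isBiinvariant_fixedSpace y.2 v hv.2 s).1⟩,
      ⟨(hW v hv.1 s).2, (isBiinvariant_fixedSpace y.2 v hv.2 s).2⟩⟩)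
    fun hbot => hw.2 <| Subtype.ext <| (Submodule.mem_bot ℂ).1 <|
      hbot ▸ ⟨w.2, (hy w w.2).2 hwz⟩
  refine ⟨c, ?_⟩
  rw [← mul_comm_of_mem_center z.2]
  exact (hy e he.mem).1 ((hU.symm ▸ he.mem : e ∈ W ⊓ fixedSpace (y : GroupAlgebra K)).2)

/-- The convolution unit of a minimal bi-invariant space is the function of a character. -/
theorem IsConvUnit.exists_isCharacterFunction [T2Space K] {W : Submodule ℂ C(K, ℂ)}
    [FiniteDimensional ℂ W] (hW : IsBiinvariant W) (hne : W ≠ ⊥)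
    (hmin : ∀ U ≤ W, IsBiinvariant U → U ≠ ⊥ → U = W) {e : C(K, ℂ)} (he : IsConvUnit W e) :
    ∃ σ : Character K, IsCharacterFunction σ e := by
  choose s hs using he.exists_mul_eq_smul hW hne hmin
  have he0 : ofContinuous e ≠ 0 := fun h =>
    he.ne_zero hne (ofContinuous_injective (h.trans (map_zero _).symm))
  have huniq {z : groupCenter K} {c : ℂ}
      (h : (z : GroupAlgebra K) * ofContinuous e = c • ofContinuous e) : s z = c :=
    smul_left_injective ℂ he0 ((hs z).symm.trans h)
  let σ : groupCenter K →⋆ₙₐ[ℂ] ℂ :=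
    { toFun := s
      map_smul' := fun c z => huniq <| by
        change (c • (z : GroupAlgebra K)) * ofContinuous e = _
        rw [smul_mul_assoc, hs, smul_smul]; rfl
      map_zero' := huniq <| by
        change (0 : GroupAlgebra K) * ofContinuous e = _
        rw [zero_mul, zero_smul]
      map_add' := fun y z => huniq <| by
        change ((y : GroupAlgebra K) + (z : GroupAlgebra K)) * ofContinuous e = _
        rw [add_mul, hs, hs, add_smul]
      map_mul' := fun y z => huniq <| by
        change ((y : GroupAlgebra K) * (z : GroupAlgebra K)) * ofContinuous e = _
        rw [mul_assoc, hs, mul_smul_comm, hs, smul_smul, mul_comm]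
      map_star' := fun z => huniq <| by
        change star (z : GroupAlgebra K) * ofContinuous e = _
        have h := congrArg star (hs z)
        rw [star_mul, star_smul, he.star_eq] at h
        exact (mul_comm_of_mem_center (star z).2 _).symm.trans h }
  have hσ : σ ⟨_, he.mem_center⟩ = 1 := huniq (by rw [one_smul]; exact he.mul_self)
  refine ⟨⟨σ, fun h => ?_⟩, isCharacterFunction_iff.2 ⟨he.mem_center, hs, hσ⟩⟩
  rw [h] at hσ
  exact zero_ne_one hσ

/-! ### Convolution operators on `L₂` -/

/-- The inclusion of `L₂ (K)` in the group algebra. -/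
noncomputable def ofL2 : Lp ℂ 2 (haarProb K) →L[ℂ] GroupAlgebra K :=
  LinearMap.mkContinuous
    { toFun := fun g => GroupAlgebra.mk g ((Lp.memLp g).integrable one_le_two)
      map_add' := fun g h => GroupAlgebra.ext_ae <| by
        refine (GroupAlgebra.toFun_mk _ _).trans ((Lp.coeFn_add g h).trans ?_)
        refine Filter.EventuallyEq.trans ?_ (GroupAlgebra.toFun_add _ _).symm
        exact ((GroupAlgebra.toFun_mk _ _).add (GroupAlgebra.toFun_mk _ _)).symm
      map_smul' := fun c g => GroupAlgebra.ext_ae <| by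
        refine (GroupAlgebra.toFun_mk _ _).trans ((Lp.coeFn_smul c g).trans ?_)
        refine Filter.EventuallyEq.trans ?_ (GroupAlgebra.toFun_smul _ _).symm
        exact ((GroupAlgebra.toFun_mk _ _).const_smul c).symm } 1 fun g => by
    rw [one_mul]
    change ‖((Lp.memLp g).integrable one_le_two).toL1 g‖ ≤ ‖g‖
    rw [Integrable.toL1, Lp.norm_toLp, Lp.norm_def]
    exact ENNReal.toReal_mono (Lp.eLpNorm_ne_top g)
      (eLpNorm_le_eLpNorm_of_exponent_le one_le_two (Lp.aestronglyMeasurable g))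

theorem toFun_ofL2 (g : Lp ℂ 2 (haarProb K)) : (ofL2 g).toFun =ᵐ[haarProb K] g :=
  GroupAlgebra.toFun_mk _ ((Lp.memLp g).integrable one_le_two)

/-- The embedding of the continuous functions in `L₂ (K)`. -/
noncomputable def toL2 : C(K, ℂ) →L[ℂ] Lp ℂ 2 (haarProb K) :=
  ContinuousMap.toLp (E := ℂ) 2 (haarProb K) ℂ

theorem coeFn_toL2 (φ : C(K, ℂ)) : toL2 φ =ᵐ[haarProb K] φ :=
  ContinuousMap.coeFn_toLp (haarProb K) φ

theorem denseRange_toL2 [T2Space K] : DenseRange (toL2 : C(K, ℂ) → Lp ℂ 2 (haarProb K)) :=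
  ContinuousMap.toLp_denseRange ℂ (haarProb K) ℂ ENNReal.ofNat_ne_top

theorem ofL2_toL2 (φ : C(K, ℂ)) : ofL2 (toL2 φ) = ofContinuous φ :=
  GroupAlgebra.ext_ae ((toFun_ofL2 _).trans ((coeFn_toL2 φ).trans (toFun_ofContinuous φ).symm))

/-- The operator `g ↦ g ∗ φ` on `L₂ (K)`, for a continuous function `φ`. -/
noncomputable def convL2 (φ : C(K, ℂ)) : Lp ℂ 2 (haarProb K) →L[ℂ] Lp ℂ 2 (haarProb K) :=
  toL2 ∘L convRight φ ∘L ofL2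

theorem convL2_apply (φ : C(K, ℂ)) (g : Lp ℂ 2 (haarProb K)) :
    convL2 φ g = toL2 (convRight φ (ofL2 g)) := rfl

theorem convL2_toL2 (φ h : C(K, ℂ)) :
    convL2 φ (toL2 h) = toL2 (convRight φ (ofContinuous h)) := by
  rw [convL2_apply, ofL2_toL2]

theorem isCompactOperator_convL2 (φ : C(K, ℂ)) : IsCompactOperator (convL2 φ) :=
  ((isCompactOperator_integralAgainst (leftFamily φ)).comp_clm ofL2).clm_comp toL2

theorem convL2_convL2 {φ ψ χ : C(K, ℂ)} (h : ofContinuous φ * ofContinuous ψ = ofContinuous χ)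
    (g : Lp ℂ 2 (haarProb K)) : convL2 ψ (convL2 φ g) = convL2 χ g := by
  simp only [convL2_apply, ofL2_toL2]
  congr 1
  apply ofContinuous_injective
  simp only [ofContinuous_convRight, mul_assoc, h]

theorem inner_toL2 (g h : C(K, ℂ)) :
    inner ℂ (toL2 g) (toL2 h) = conv (involMap g) h 1 := by
  refine (ContinuousMap.inner_toLp (haarProb K) g h).trans ?_
  rw [conv, ← integral_inv_eq_self _ (haarProb K)]
  refine integral_congr_ae (Filter.Eventually.of_forall fun y => ?_)
  simp [coe_involMap, invol, mul_comm]

theorem conv_apply_one_comm (f g : K → ℂ) : conv f g 1 = conv g f 1 := by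
  rw [conv_eq_integral_inv]
  simp [conv]

/-- Convolution with a self-adjoint continuous function is a symmetric operator. This holds as
`⟪g, h⟫ = (g̃ ∗ h)(1)`, where the value of a product at `1` does not depend on the order of the
factors. -/
theorem isSymmetric_convL2 [T2Space K] {u : C(K, ℂ)} (hu : invol u = u) :
    (convL2 u : Lp ℂ 2 (haarProb K) →ₗ[ℂ] Lp ℂ 2 (haarProb K)).IsSymmetric := by
  intro g h
  change inner ℂ (convL2 u g) h = inner ℂ g (convL2 u h)
  refine denseRange_toL2.induction_on₂
    (p := fun g h => inner ℂ (convL2 u g) h = inner ℂ g (convL2 u h))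
    (isClosed_eq (by fun_prop) (by fun_prop)) (fun a b => ?_) g h
  have hL (v w : C(K, ℂ)) (x : K) : convRight v (ofContinuous w) x = conv w v x := by
    rw [convRight_apply, conv_congr (toFun_ofContinuous w) (Filter.EventuallyEq.refl _ _)]
  have hstar : star (ofContinuous u) = ofContinuous u := by
    rw [← ofContinuous_involMap]
    exact congrArg _ (DFunLike.coe_injective hu)
  rw [convL2_toL2, convL2_toL2, inner_toL2, inner_toL2, ← hL, ← hL]
  have h1 : convRight b (ofContinuous (involMap (convRight u (ofContinuous a)))) =
      convRight (convRight b (ofContinuous (involMap a))) (ofContinuous u) := by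
    apply ofContinuous_injective
    simp only [ofContinuous_convRight, ofContinuous_involMap, star_mul, hstar, mul_assoc]
  have h2 : convRight (convRight u (ofContinuous b)) (ofContinuous (involMap a)) =
      convRight u (ofContinuous (convRight b (ofContinuous (involMap a)))) := by
    apply ofContinuous_injective
    simp only [ofContinuous_convRight, mul_assoc]
  rw [h1, h2, hL, hL, conv_apply_one_comm]

end CompactGroup

/-! ### Sums of orthogonal projections -/

/-- A jointly faithful family of mutually orthogonal symmetric idempotents sums to the identity. -/
theorem hasSum_of_symmetric_idempotent {ι H : Type*} [NormedAddCommGroup H]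
    [InnerProductSpace ℂ H] [CompleteSpace H] (P : ι → H →L[ℂ] H)
    (hsymm : ∀ i, (P i : H →ₗ[ℂ] H).IsSymmetric) (hidem : ∀ i x, P i (P i x) = P i x)
    (horth : ∀ i j, i ≠ j → ∀ x, P i (P j x) = 0) (hfaith : ∀ x, (∀ i, P i x = 0) → x = 0)
    (x : H) : HasSum (fun i => P i x) x := by
  classical
  let F : ι → Submodule ℂ H := fun i => (1 - P i : H →L[ℂ] H).ker
  have hmem {i : ι} {v : H} : v ∈ F i ↔ P i v = v := by
    rw [LinearMap.mem_ker]
    change v - P i v = 0 ↔ _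
    rw [sub_eq_zero, eq_comm]
  have hs (i : ι) (v w : H) : inner ℂ (P i v) w = inner ℂ v (P i w) := hsymm i v w
  have hcomplete (i : ι) : CompleteSpace (F i) :=
    ((1 - P i : H →L[ℂ] H).isClosed_ker).completeSpace_coe
  have hF : IsHilbertSum ℂ (fun i => F i) fun i => (F i).subtypeₗᵢ := by
    refine IsHilbertSum.mkInternal F (fun i j hij v w => ?_) ?_
    · change inner ℂ (v : H) (w : H) = 0
      rw [← hmem.1 v.2, hs, ← hmem.1 w.2, horth i j hij, inner_zero_right]
    · rw [top_le_iff, Submodule.topologicalClosure_eq_top_iff, Submodule.eq_bot_iff]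
      refine fun v hv => hfaith v fun i => ?_
      rw [← inner_self_eq_zero (𝕜 := ℂ), hs, hidem, ← hs]
      exact (Submodule.mem_orthogonal _ _).1 hv _
        (Submodule.mem_iSup_of_mem i (hmem.2 (hidem i v)))
  have hsum := hF.hasSum_linearIsometryEquiv_symm (hF.linearIsometryEquiv x)
  rw [LinearIsometryEquiv.symm_apply_apply] at hsum
  convert hsum using 2 with j
  set c := hF.linearIsometryEquiv x
  -- Applying `P j` to the expansion of `x` leaves only the component of index `j`.
  have h1 := (P j).hasSum hsum
  have h2 : HasSum (fun i => P j ((F i).subtypeₗᵢ (c i))) (P j ((F j).subtypeₗᵢ (c j))) := by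
    refine hasSum_single j fun i hij => ?_
    change P j (c i : H) = 0
    rw [← hmem.1 (c i).2, horth j i hij.symm]
  rw [h1.unique h2]
  exact hmem.1 (c j).2

section CompactGroup

set_option linter.unusedSectionVars false

variable {K : Type*} [Group K] [TopologicalSpace K] [IsTopologicalGroup K] [CompactSpace K]
  [MeasurableSpace K] [BorelSpace K] [SecondCountableTopology K]

/-! ### Completeness of the characters -/

/-- A function in `L₂` that is annihilated by the functions of all characters is orthogonal to
every finite-dimensional bi-invariant space: a space of minimal dimension to which it is not
orthogonal would be a minimal bi-invariant space, hence belong to a character. -/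
theorem inner_eq_zero_of_isBiinvariant [T2Space K] {g : Lp ℂ 2 (haarProb K)}
    (hg : ∀ σ : Character K, convL2 (characterFunction σ) g = 0) (W : Submodule ℂ C(K, ℂ))
    [FiniteDimensional ℂ W] (hW : IsBiinvariant W) : ∀ w ∈ W, inner ℂ (toL2 w) g = 0 := by
  induction hn : Module.finrank ℂ W using Nat.strong_induction_on generalizing W with
  | _ n ih =>
  subst hn
  obtain ⟨e, he⟩ := hW.exists_isConvUnit
  have hlt {U : Submodule ℂ C(K, ℂ)} (hU : U ≤ W) (hne : U ≠ W) (hUinv : IsBiinvariant U) :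
      ∀ w ∈ U, inner ℂ (toL2 w) g = 0 := by
    have : FiniteDimensional ℂ U := Submodule.finiteDimensional_of_le hU
    exact ih _ (Submodule.finrank_lt_finrank_of_lt (lt_of_le_of_ne hU hne)) U hUinv rfl
  by_cases hbot : W = ⊥
  · intro w hw
    rw [hbot, Submodule.mem_bot] at hw
    rw [hw, map_zero, inner_zero_left]
  by_cases hmin : ∀ U ≤ W, IsBiinvariant U → U ≠ ⊥ → U = W
  · obtain ⟨σ, hσ⟩ := he.exists_isCharacterFunction hW hbot hmin
    intro w hw
    have h1 : convL2 e (toL2 w) = toL2 w := by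
      rw [convL2_toL2]
      congr 1
      apply ofContinuous_injective
      rw [ofContinuous_convRight, he.mul_eq w hw]
    have h2 : inner ℂ (convL2 e (toL2 w)) g = inner ℂ (toL2 w) (convL2 e g) :=
      isSymmetric_convL2 he.invol_eq (toL2 w) g
    rw [← h1, h2, hσ.unique (isCharacterFunction_characterFunction σ), hg, inner_zero_right]
  · push Not at hmin
    obtain ⟨U, hU, hUinv, hU0, hUW⟩ := hmin
    have : FiniteDimensional ℂ U := Submodule.finiteDimensional_of_le hU
    obtain ⟨d, hd⟩ := hUinv.exists_isConvUnit
    -- The complement of `U` in `W` consists of the `w` with `w ∗ d = 0`.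
    let y : groupCenter K :=
      ⟨ofContinuous e, he.mem_center⟩ + (-1 : ℂ) • ⟨ofContinuous d, hd.mem_center⟩
    have hy : (y : GroupAlgebra K) = ofContinuous e - ofContinuous d := by
      change ofContinuous e + (-1 : ℂ) • ofContinuous d = _
      rw [neg_one_smul, sub_eq_add_neg]
    have hfix (w : C(K, ℂ)) (hw : w ∈ W) : w ∈ fixedSpace (y : GroupAlgebra K) ↔
        ofContinuous w * ofContinuous d = 0 := by
      rw [mem_fixedSpace, hy, mul_sub, he.mul_eq w hw, sub_eq_self]
    let U' := W ⊓ fixedSpace (y : GroupAlgebra K)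
    have hU'inv : IsBiinvariant U' := fun v hv s =>
      ⟨⟨(hW v hv.1 s).1, (isBiinvariant_fixedSpace y.2 v hv.2 s).1⟩,
        ⟨(hW v hv.1 s).2, (isBiinvariant_fixedSpace y.2 v hv.2 s).2⟩⟩
    have hU'W : U' ≠ W := fun h => hd.ne_zero hU0 <| ofContinuous_injective <| by
      have hdU' : d ∈ U' := h ▸ hU hd.mem
      rw [map_zero, ← (hfix d hdU'.1).1 hdU'.2, hd.mul_self]
    intro w hw
    have hw1 : convRight d (ofContinuous w) ∈ U := hUinv.convRight_mem hd.mem _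
    have hw2 : w - convRight d (ofContinuous w) ∈ U' := by
      have hmem := W.sub_mem hw (hU hw1)
      refine ⟨hmem, (hfix _ hmem).2 ?_⟩
      rw [map_sub, ofContinuous_convRight, sub_mul, mul_assoc, hd.mul_self, sub_self]
    have h1 := hlt hU hUW hUinv _ hw1
    have h2 := hlt inf_le_left hU'W hU'inv _ hw2
    rw [map_sub, inner_sub_left, h1, sub_zero] at h2
    exact h2

/-- A function in `L₂` that is annihilated by the functions of all characters is annihilated by
every self-adjoint central continuous function `u`, by the spectral theorem: the eigenspaces of
`u` for nonzero eigenvalues are finite-dimensional bi-invariant spaces of continuous functions. -/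
theorem convL2_eq_zero_of_forall_character [T2Space K] {g : Lp ℂ 2 (haarProb K)}
    (hg : ∀ σ : Character K, convL2 (characterFunction σ) g = 0) {u : C(K, ℂ)}
    (hu : invol u = u) (huc : ofContinuous u ∈ groupCenter K) : convL2 u g = 0 := by
  have hsymm := isSymmetric_convL2 hu
  have hs (v w : Lp ℂ 2 (haarProb K)) : inner ℂ (convL2 u v) w = inner ℂ v (convL2 u w) :=
    hsymm v w
  have horth := ContinuousLinearMap.orthogonalComplement_iSup_eigenspaces_eq_bot
    (isCompactOperator_convL2 u) hsymm
  rw [← Submodule.mem_bot ℂ, ← horth]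
  suffices h : (⨆ μ, Module.End.eigenspace
      (convL2 u : Module.End ℂ (Lp ℂ 2 (haarProb K))) μ) ≤ (ℂ ∙ convL2 u g)ᗮ from
    (Submodule.mem_orthogonal _ _).2 fun v hv =>
      Submodule.mem_orthogonal_singleton_iff_inner_left.1 (h hv)
  refine iSup_le fun μ v hv => ?_
  have hv' : convL2 u v = μ • v := Module.End.mem_eigenspace_iff.1 hv
  rw [Submodule.mem_orthogonal_singleton_iff_inner_left, ← hs, hv', inner_smul_left]
  by_cases hμ : μ = 0
  · rw [hμ, map_zero, zero_mul]
  let h : C(K, ℂ) := μ⁻¹ • convRight u (ofL2 v)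
  have hhv : toL2 h = v := by
    rw [map_smul, ← convL2_apply, hv', inv_smul_smul₀ hμ]
  let z : groupCenter K := μ⁻¹ • ⟨ofContinuous u, huc⟩
  have hz : (z : GroupAlgebra K) = μ⁻¹ • ofContinuous u := rfl
  have hmem : h ∈ fixedSpace (z : GroupAlgebra K) := by
    rw [mem_fixedSpace, hz, mul_smul_comm, ← ofL2_toL2, hhv, ← ofContinuous_convRight, ← map_smul,
      ← ofL2_toL2, hhv]
  rw [← hhv, inner_eq_zero_of_isBiinvariant hg _ (isBiinvariant_fixedSpace z.2) h hmem, mul_zero]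

end CompactGroup

section BiinvariantMetric

variable {K : Type*} [Group K] [MetricSpace K] [IsTopologicalGroup K] [CompactSpace K]
  [MeasurableSpace K] [BorelSpace K] [SecondCountableTopology K]

/-- For a bi-invariant metric there are central approximate identities, namely the normalized
functions `x ↦ max (δ - dist x 1) 0`. -/
theorem exists_central_approximation (hl : ∀ s a b : K, dist (s * a) (s * b) = dist a b)
    (hr : ∀ s a b : K, dist (a * s) (b * s) = dist a b) (F : C(K, ℂ)) {ε : ℝ} (hε : 0 < ε) :
    ∃ u : C(K, ℂ), invol u = u ∧ ofContinuous u ∈ groupCenter K ∧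
      ‖convLeft F (ofContinuous u) - F‖ ≤ ε := by
  obtain ⟨δ, hδ, hF⟩ := Metric.uniformContinuous_iff.1
    (CompactSpace.uniformContinuous_of_continuous F.continuous) ε hε
  let p : K → ℝ := fun x => max (δ - dist x 1) 0
  have hp : Continuous p := by fun_prop
  have hp0 (x : K) : 0 ≤ p x := le_max_right _ _
  have hpquot (x y : K) : p (y⁻¹ * x) = max (δ - dist x y) 0 := by
    change max (δ - dist (y⁻¹ * x) 1) 0 = _
    rw [← hl y, mul_inv_cancel_left, mul_one]
  have hpquot' (x y : K) : p (x * y⁻¹) = max (δ - dist x y) 0 := by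
    change max (δ - dist (x * y⁻¹) 1) 0 = _
    rw [← hr y, inv_mul_cancel_right, one_mul]
  let c : ℝ := ∫ x, p x ∂haarProb K
  have hc : 0 < c := by
    refine hp.integral_pos_of_hasCompactSupport_nonneg_nonzero
      (HasCompactSupport.of_compactSpace _) hp0 (x := 1) ?_
    change max (δ - dist (1 : K) 1) 0 ≠ 0
    rw [dist_self, sub_zero, max_eq_left hδ.le]
    exact hδ.ne'
  let u : C(K, ℂ) := ⟨fun x => ((c⁻¹ * p x : ℝ) : ℂ), by fun_prop⟩
  have hu (x : K) : u x = ((c⁻¹ * p x : ℝ) : ℂ) := rfl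
  refine ⟨u, ?_, ?_, ?_⟩
  · funext x
    have : p x⁻¹ = p x := by
      have h1 := hpquot 1 x
      rw [mul_one, dist_comm] at h1
      exact h1
    rw [invol, hu, hu, this]
    exact Complex.conj_ofReal _
  · refine NonUnitalStarSubalgebra.mem_center_iff.2 fun g => ?_
    rw [← ofContinuous_convRight, ← ofContinuous_convLeft]
    congr 1
    ext x
    rw [convRight_apply, convLeft_apply, conv_eq_integral_inv u]
    simp only [conv, hu, hpquot, hpquot']
  · rw [ContinuousMap.norm_le _ hε.le]
    intro x
    have hpx : Integrable (fun y => c⁻¹ * p (y⁻¹ * x)) (haarProb K) := by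
      refine Integrable.const_mul ?_ _
      exact (show Continuous fun y => p (y⁻¹ * x) by fun_prop).integrable_of_hasCompactSupport
        (HasCompactSupport.of_compactSpace _)
    have hmass : ∫ y, c⁻¹ * p (y⁻¹ * x) ∂haarProb K = 1 := by
      rw [integral_const_mul]
      have : ∫ y, p (y⁻¹ * x) ∂haarProb K = c := by
        rw [integral_inv_eq_self (fun y => p (y * x)), integral_mul_right_eq_self]
      rw [this, inv_mul_cancel₀ hc.ne']
    have hmass' : ∫ y, u (y⁻¹ * x) ∂haarProb K = 1 := by
      simp only [hu]
      rw [integral_complex_ofReal, hmass, Complex.ofReal_one]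
    have hint1 : Integrable (fun y => F y * u (y⁻¹ * x)) (haarProb K) :=
      integrable_continuousMap ⟨fun y => F y * u (y⁻¹ * x), by fun_prop⟩
    have hint2 : Integrable (fun y => F x * u (y⁻¹ * x)) (haarProb K) :=
      integrable_continuousMap ⟨fun y => F x * u (y⁻¹ * x), by fun_prop⟩
    have hdiff : (convLeft F (ofContinuous u) - F) x =
        ∫ y, (F y - F x) * u (y⁻¹ * x) ∂haarProb K := by
      simp only [sub_mul]
      rw [integral_sub hint1 hint2, integral_const_mul, hmass', mul_one, ContinuousMap.sub_apply,
        convLeft_ofContinuous_apply, conv]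
    rw [hdiff]
    calc ‖∫ y, (F y - F x) * u (y⁻¹ * x) ∂haarProb K‖
        ≤ ∫ y, ε * (c⁻¹ * p (y⁻¹ * x)) ∂haarProb K := by
          refine norm_integral_le_of_norm_le (hpx.const_mul ε)
            (Filter.Eventually.of_forall fun y => ?_)
          have hnn : 0 ≤ c⁻¹ * p (y⁻¹ * x) := mul_nonneg (inv_nonneg.2 hc.le) (hp0 _)
          rw [norm_mul, hu, Complex.norm_of_nonneg hnn]
          by_cases hxy : dist y x < δ
          · refine mul_le_mul_of_nonneg_right ?_ hnn
            rw [← dist_eq_norm]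
            exact (hF hxy).le
          · have : p (y⁻¹ * x) = 0 := by
              rw [hpquot, dist_comm]
              exact max_eq_right (by linarith)
            rw [this, mul_zero, mul_zero, mul_zero]
      _ = ε := by rw [integral_const_mul, hmass, mul_one]

/-- A function in `L₂` that is annihilated by the functions of all characters is zero. -/
theorem eq_zero_of_forall_convL2_characterFunction
    (hl : ∀ s a b : K, dist (s * a) (s * b) = dist a b)
    (hr : ∀ s a b : K, dist (a * s) (b * s) = dist a b) {g : Lp ℂ 2 (haarProb K)}
    (hg : ∀ σ : Character K, convL2 (characterFunction σ) g = 0) : g = 0 := by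
  have h0 (F : C(K, ℂ)) : inner ℂ g (toL2 F) = 0 := by
    refine norm_le_zero_iff.1 (le_of_forall_pos_le_add fun ε hε => ?_)
    set M : ℝ := ‖g‖ * ‖(toL2 : C(K, ℂ) →L[ℂ] Lp ℂ 2 (haarProb K))‖
    have hM : 0 ≤ M := by positivity
    -- The denominator is `M + 1` because `M` may be zero.
    obtain ⟨u, hu, huc, hF⟩ := exists_central_approximation hl hr F
      (show 0 < ε / (M + 1) by positivity)
    have h1 : inner ℂ g (toL2 (convLeft F (ofContinuous u))) = 0 := by
      have h2 : toL2 (convLeft F (ofContinuous u)) = convL2 u (toL2 F) := by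
        rw [convL2_toL2]
        congr 1
        apply ofContinuous_injective
        rw [ofContinuous_convLeft, ofContinuous_convRight]
      have h3 : inner ℂ (convL2 u g) (toL2 F) = inner ℂ g (convL2 u (toL2 F)) :=
        isSymmetric_convL2 hu g (toL2 F)
      rw [h2, ← h3, convL2_eq_zero_of_forall_character hg hu huc, inner_zero_left]
    have h4 : inner ℂ g (toL2 F) = -inner ℂ g (toL2 (convLeft F (ofContinuous u) - F)) := by
      rw [map_sub, inner_sub_right, h1, zero_sub, neg_neg]
    rw [zero_add, h4, norm_neg]
    calc ‖inner ℂ g (toL2 (convLeft F (ofContinuous u) - F))‖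
        ≤ ‖g‖ * ‖toL2 (convLeft F (ofContinuous u) - F)‖ := norm_inner_le_norm _ _
      _ ≤ ‖g‖ * (‖(toL2 : C(K, ℂ) →L[ℂ] Lp ℂ 2 (haarProb K))‖ * (ε / (M + 1))) := by
          refine mul_le_mul_of_nonneg_left ?_ (norm_nonneg _)
          exact (toL2.le_opNorm _).trans (mul_le_mul_of_nonneg_left hF (norm_nonneg _))
      _ = ε * (M / (M + 1)) := by rw [← mul_assoc]; change M * _ = _; ring
      _ ≤ ε := mul_le_of_le_one_right hε.le (div_le_one_of_le₀ (by linarith) (by linarith))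
  have h5 := denseRange_toL2.induction_on (p := fun v => inner ℂ g v = 0) g
    (isClosed_eq (by fun_prop) continuous_const) h0
  exact inner_self_eq_zero.1 h5

/-- The expansion of a function in `L₂` with respect to the characters. -/
theorem hasSum_convL2_characterFunction
    (hl : ∀ s a b : K, dist (s * a) (s * b) = dist a b)
    (hr : ∀ s a b : K, dist (a * s) (b * s) = dist a b) (g : Lp ℂ 2 (haarProb K)) :
    HasSum (fun σ : Character K => convL2 (characterFunction σ) g) g := by
  refine hasSum_of_symmetric_idempotent _
    (fun σ => isSymmetric_convL2 (invol_characterFunction σ))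
    (fun σ g => convL2_convL2 (characterFunction_mul_self σ) g) (fun σ τ h g => ?_)
    (fun g hg => eq_zero_of_forall_convL2_characterFunction hl hr hg) g
  have h0 : ofContinuous (characterFunction τ) * ofContinuous (characterFunction σ) =
      ofContinuous 0 := by
    rw [map_zero, characterFunction_mul_of_ne h.symm]
  rw [convL2_convL2 h0, convL2_apply]
  have : convRight (0 : C(K, ℂ)) (ofL2 g) = 0 := by
    apply ofContinuous_injective
    rw [ofContinuous_convRight, map_zero, mul_zero]
  rw [this, map_zero]

end BiinvariantMetric

section CompactGroup

set_option linter.unusedSectionVars false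

variable {K : Type*} [Group K] [TopologicalSpace K] [IsTopologicalGroup K] [CompactSpace K]
  [MeasurableSpace K] [BorelSpace K] [SecondCountableTopology K]

/-! ### Minimal almost invariant functions -/

/-- A finite-dimensional space of continuous functions that is closed under the translations by
the elements of a dense set is bi-invariant. -/
theorem isBiinvariant_of_dense {U : Submodule ℂ C(K, ℂ)} [FiniteDimensional ℂ U] {D : Set K}
    (hD : Dense D) (hU : ∀ u ∈ U, ∀ s ∈ D,
      u.comp (ContinuousMap.mulLeft s) ∈ U ∧ u.comp (ContinuousMap.mulRight s) ∈ U) :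
    IsBiinvariant U := by
  have hcl : IsClosed (U : Set C(K, ℂ)) := U.closed_of_finiteDimensional
  intro u hu s
  have hL (s : K) : u.comp (ContinuousMap.mulLeft s) = leftFamily u s⁻¹ := by
    ext x; simp [leftFamily]
  have hR (s : K) : u.comp (ContinuousMap.mulRight s) = rightFamily u s⁻¹ := by
    ext x; simp [rightFamily]
  constructor
  · refine (hcl.preimage (f := fun s => u.comp (ContinuousMap.mulLeft s)) ?_).closure_subset_iff.2
      (fun s hs => (hU u hu s hs).1) (hD s)
    simp only [hL]
    fun_prop
  · refine (hcl.preimage (f := fun s => u.comp (ContinuousMap.mulRight s)) ?_).closure_subset_iff.2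
      (fun s hs => (hU u hu s hs).2) (hD s)
    simp only [hR]
    fun_prop

/-- The functions in the space that belongs to a character of `K` restrict to minimal almost
invariant functions along every continuous homomorphism to `K` with dense range. -/
theorem isMinimalAlmostInvariant_comp [T2Space K] {H : Type*} [Group H] [TopologicalSpace H]
    (φ : H →* K) (hφ : Continuous φ) (hd : DenseRange φ) (σ : Character K) {h : C(K, ℂ)}
    (hh : h ∈ fixedSpace (ofContinuous (characterFunction σ))) :
    IsMinimalAlmostInvariant fun a => h (φ a) := by
  set A := fixedSpace (ofContinuous (characterFunction σ))
  have hA : IsBiinvariant A := isBiinvariant_fixedSpace (characterFunction_mem_center σ)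
  let ρ : C(K, ℂ) →ₗ[ℂ] (H → ℂ) :=
    { toFun := fun u a => u (φ a)
      map_add' := fun _ _ => rfl
      map_smul' := fun _ _ => rfl }
  have hle : translationSpan (fun a => h (φ a)) ≤ A.map ρ := by
    refine Submodule.span_le.2 ?_
    rintro _ ⟨p, rfl⟩
    refine ⟨(h.comp (ContinuousMap.mulLeft (φ p.1))).comp (ContinuousMap.mulRight (φ p.2)),
      (hA _ (hA h hh _).1 _).2, ?_⟩
    funext x
    simp [ρ, mul_assoc]
  have hleft : leftSpan (fun a => h (φ a)) ≤ translationSpan (fun a => h (φ a)) := by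
    refine Submodule.span_mono ?_
    rintro _ ⟨s, rfl⟩
    exact ⟨(s, 1), by simp⟩
  have hright : rightSpan (fun a => h (φ a)) ≤ translationSpan (fun a => h (φ a)) := by
    refine Submodule.span_mono ?_
    rintro _ ⟨s, rfl⟩
    exact ⟨(1, s), by simp⟩
  have hfin : FiniteDimensional ℂ (translationSpan fun a => h (φ a)) :=
    Submodule.finiteDimensional_of_le hle
  refine ⟨⟨h.continuous.comp hφ, Submodule.finiteDimensional_of_le hleft,
    Submodule.finiteDimensional_of_le hright⟩, hfin, fun W hW hne hinv => ?_⟩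
  -- Pull `W` back to `K`. The result is closed under translations by the image of `H`, which is
  -- dense, and so bi-invariant.
  let U : Submodule ℂ C(K, ℂ) := A ⊓ W.comap ρ
  have : FiniteDimensional ℂ U := Submodule.finiteDimensional_of_le inf_le_left
  have hU : IsBiinvariant U := by
    refine isBiinvariant_of_dense hd ?_
    rintro u ⟨huA, huW⟩ _ ⟨s, rfl⟩
    refine ⟨⟨(hA u huA _).1, ?_⟩, ⟨(hA u huA _).2, ?_⟩⟩
    · have := (hinv _ huW s).1
      simpa [ρ] using this
    · have := (hinv _ huW s).2
      simpa [ρ] using this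
  have hU0 : U ≠ ⊥ := fun hbot => by
    obtain ⟨w, hw, hw0⟩ := Submodule.exists_mem_ne_zero_of_ne_bot hne
    obtain ⟨a, ha, rfl⟩ := hle (hW hw)
    have haU : a ∈ U := ⟨ha, hw⟩
    rw [hbot, Submodule.mem_bot] at haU
    exact hw0 (by rw [haU, map_zero])
  have hUA := eq_fixedSpace_characterFunction σ hU inf_le_left hU0
  refine le_antisymm hW (hle.trans ?_)
  rintro _ ⟨a, ha, rfl⟩
  have haU : a ∈ U := hUA ▸ ha
  exact haU.2

end CompactGroup

section Completion

variable {G : Type*} [Group G] [TopologicalSpace G] [IsTopologicalGroup G] {f : G →ᵇ ℂ}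

/-! ### The completion of an almost periodic function -/

/-- The pseudometric of an almost periodic function is continuous: by total boundedness, the
supremum over `x` and `y` is approximated by a maximum over finitely many `x` and `y`. -/
theorem tendsto_apDist (hf : IsAlmostPeriodic f) (b : G) :
    Filter.Tendsto (fun a => apDist f a b) (nhds b) (nhds 0) := by
  refine Metric.tendsto_nhds.2 fun ε hε => ?_
  have h6 : 0 < ε / 6 := by positivity
  obtain ⟨S, hSsub, hS, hScov⟩ := Metric.finite_approx_of_totallyBounded hf.left (ε / 6) h6
  obtain ⟨T, hTsub, hT, hTcov⟩ := Metric.finite_approx_of_totallyBounded hf.right (ε / 6) h6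
  choose! x hx using fun g (hg : g ∈ S) => hSsub hg
  choose! y hy using fun g (hg : g ∈ T) => hTsub hg
  have hfin : ∀ᶠ a in nhds b, ∀ g ∈ S, ∀ k ∈ T,
      dist (f (x g * a * y k)) (f (x g * b * y k)) < ε / 6 := by
    refine (Filter.eventually_all_finite hS).2 fun g _ => (Filter.eventually_all_finite hT).2
      fun k _ => ?_
    have hc : Continuous fun a => f (x g * a * y k) := by fun_prop
    exact Metric.tendsto_nhds.1 (hc.tendsto b) _ h6
  filter_upwards [hfin] with a ha
  have hnn : 0 ≤ apDist f a b := dist_nonneg (α := PseudoGroup f) (x := a) (y := b)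
  rw [Real.dist_0_eq_abs, abs_of_nonneg hnn]
  refine (apDist_le f (c := 5 * (ε / 6)) fun s t => ?_).trans_lt (by linarith)
  have h1 := hScov ⟨s, rfl⟩
  have h2 := hTcov ⟨t, rfl⟩
  simp only [Set.mem_iUnion, Metric.mem_ball] at h1 h2
  obtain ⟨g, hg, hgs⟩ := h1
  obtain ⟨k, hk, hkt⟩ := h2
  rw [← hx g hg] at hgs
  rw [← hy k hk] at hkt
  have hl (z : G) : dist (f (s * z)) (f (x g * z)) ≤ ε / 6 :=
    ((BoundedContinuousFunction.dist_coe_le_dist (f := leftTranslate s f) z).trans_lt hgs).le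
  have hr (z : G) : dist (f (z * t)) (f (z * y k)) ≤ ε / 6 :=
    ((BoundedContinuousFunction.dist_coe_le_dist (f := rightTranslate t f) z).trans_lt hkt).le
  rw [← dist_eq_norm]
  have l1 := hl (a * t)
  have l2 := hl (b * t)
  have r1 := hr (x g * a)
  have r2 := hr (x g * b)
  have h3 := ha g hg k hk
  rw [← mul_assoc, ← mul_assoc] at l1 l2
  rw [dist_comm] at l2 r2
  have t1 := dist_triangle4 (f (s * a * t)) (f (x g * a * t)) (f (x g * b * t)) (f (s * b * t))
  have t2 := dist_triangle4 (f (x g * a * t)) (f (x g * a * y k)) (f (x g * b * y k))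
    (f (x g * b * t))
  linarith

namespace APCompletion

variable (f) (hf : IsAlmostPeriodic f)

/-- The canonical map from `G` to `G_f`, as a homomorphism. -/
noncomputable def ofGroupHom : G →* APCompletion f hf where
  toFun := ofGroup f hf
  map_one' := ofGroup_one f hf
  map_mul' := ofGroup_mul f hf

theorem continuous_ofGroup : Continuous (ofGroup f hf) := by
  refine continuous_iff_continuousAt.2 fun b => ?_
  rw [ContinuousAt, tendsto_iff_dist_tendsto_zero]
  simp only [dist_ofGroup]
  exact tendsto_apDist hf b

theorem dist_mul_left_eq (s a b : APCompletion f hf) : dist (s * a) (s * b) = dist a b := by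
  refine (denseRange_ofGroup f hf).induction_on₃ (p := fun s a b => dist (s * a) (s * b) = dist a b)
    (isClosed_eq (by fun_prop) (by fun_prop)) (fun s a b => ?_) s a b
  rw [← ofGroup_mul, ← ofGroup_mul, dist_ofGroup, dist_ofGroup]
  refine le_antisymm (apDist_mul_left_le f s a b) ?_
  simpa using apDist_mul_left_le f s⁻¹ (s * a) (s * b)

theorem dist_mul_right_eq (s a b : APCompletion f hf) : dist (a * s) (b * s) = dist a b := by
  refine (denseRange_ofGroup f hf).induction_on₃ (p := fun s a b => dist (a * s) (b * s) = dist a b)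
    (isClosed_eq (by fun_prop) (by fun_prop)) (fun s a b => ?_) s a b
  rw [← ofGroup_mul, ← ofGroup_mul, dist_ofGroup, dist_ofGroup]
  refine le_antisymm (apDist_mul_right_le f s a b) ?_
  simpa using apDist_mul_right_le f s⁻¹ (a * s) (b * s)

end APCompletion

end Completion

end AlmostPeriodic

theorem mainTheorem3 {G : Type*} [Group G] [TopologicalSpace G] [IsTopologicalGroup G]
    (f : G →ᵇ ℂ) (hf : AlmostPeriodic.IsAlmostPeriodic f) :
    ∃ χ : AlmostPeriodic.Character (AlmostPeriodic.APCompletion f hf) →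
        C(AlmostPeriodic.APCompletion f hf, ℂ),
      (∀ σ ψ, AlmostPeriodic.IsCharacterFunction σ ψ ↔ ψ = χ σ) ∧
      (∃ (hF : MemLp (AlmostPeriodic.APCompletion.extension f hf) 2
            (AlmostPeriodic.haarProb (AlmostPeriodic.APCompletion f hf)))
          (hT : ∀ σ, MemLp
            (AlmostPeriodic.conv (AlmostPeriodic.APCompletion.extension f hf) (χ σ)) 2
            (AlmostPeriodic.haarProb (AlmostPeriodic.APCompletion f hf))),
        HasSum (fun σ => (hT σ).toLp _) (hF.toLp _)) ∧
      ∀ σ,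
        AlmostPeriodic.IsMinimalAlmostInvariant
          (AlmostPeriodic.conv (AlmostPeriodic.APCompletion.extension f hf) (χ σ)) ∧
        AlmostPeriodic.IsMinimalAlmostInvariant (fun a : G =>
          AlmostPeriodic.conv (AlmostPeriodic.APCompletion.extension f hf) (χ σ)
            (AlmostPeriodic.APCompletion.ofGroup f hf a)) := by
  open AlmostPeriodic in
  set K := APCompletion f hf
  set F : C(K, ℂ) := APCompletion.extension f hf
  have hmem (ψ : C(K, ℂ)) : MemLp ψ 2 (haarProb K) := (Lp.memLp (toL2 ψ)).ae_eq (coeFn_toL2 ψ)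
  have htoLp (ψ : C(K, ℂ)) : (hmem ψ).toLp ψ = toL2 ψ :=
    Lp.ext ((hmem ψ).coeFn_toLp.trans (coeFn_toL2 ψ).symm)
  have hconv (σ : Character K) : conv F (characterFunction σ) =
      convLeft F (ofContinuous (characterFunction σ)) :=
    funext fun x => (convLeft_ofContinuous_apply F _ x).symm
  have hfix (σ : Character K) : convLeft F (ofContinuous (characterFunction σ)) ∈
      fixedSpace (ofContinuous (characterFunction σ)) := by
    rw [mem_fixedSpace, ofContinuous_convLeft, mul_assoc, characterFunction_mul_self]
  refine ⟨characterFunction, fun σ ψ => ⟨fun h =>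
    h.unique (isCharacterFunction_characterFunction σ), ?_⟩, ⟨hmem F, fun σ => ?_, ?_⟩,
    fun σ => ⟨?_, ?_⟩⟩
  · rintro rfl
    exact isCharacterFunction_characterFunction σ
  · rw [hconv]
    exact hmem _
  · rw [htoLp]
    convert hasSum_convL2_characterFunction (APCompletion.dist_mul_left_eq f hf)
      (APCompletion.dist_mul_right_eq f hf) (toL2 F) using 2 with σ
    have h : convRight (characterFunction σ) (ofContinuous F) =
        convLeft F (ofContinuous (characterFunction σ)) :=
      ofContinuous_injective ((ofContinuous_convRight _ _).trans (ofContinuous_convLeft _ _).symm)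
    rw [convL2_toL2, h, ← htoLp]
    exact MemLp.toLp_congr _ _ (Filter.EventuallyEq.of_eq (hconv σ))
  · rw [hconv]
    exact isMinimalAlmostInvariant_comp (MonoidHom.id K) continuous_id denseRange_id σ (hfix σ)
  · simp only [hconv]
    exact isMinimalAlmostInvariant_comp (APCompletion.ofGroupHom f hf)
      (APCompletion.continuous_ofGroup f hf) (APCompletion.denseRange_ofGroup f hf) σ (hfix σ)
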